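/- Let $\hbar>0$ and let $\psi\in L^1(\mathbb R)\cap L^2(\mathbb R)$ be such that its Fourier transform $\widehat\psi(p)=(2\pi\hbar)^{-1/2}\int e^{-ipx/\hbar}\psi(x)\,dx$ also lies in $L^1(\mathbb R)\cap L^2(\mathbb R)$. Let $$W\psi(x,p)=\frac1{2\pi\hbar}\int_{\mathbb R} e^{-\frac i\hbar py}\,\psi(x+\tfrac12y)\overline{\psi(x-\tfrac12y)}\,dy$$ be the Wigner function of $\psi$, and for $X\in\mathbb R$ and $(\mu,\nu)\in\mathbb R^2\setminus\{(0,0)\}$, with $\lambda=\sqrt{\mu^2+\nu^2}$, let $$R(X,\mu,\nu)=\int W\psi(x,p)\,\delta(X-\mu x-\nu p)\,dp\,dx$$ be its (symplectic) Radon transform, where $\delta(X-\mu x-\nu p)$ is $\lambda^{-1}$ times the arc length measure on the line $\mu x+\nu p=X$. Let $\mathrm{Mp}(1)$ be the metaplectic group: the group of unitary operators of $L^2(\mathbb R)$ generated by the quadratic Fourier transforms $$\widehat S_{\mathcal A,m}f(x)=(2\pi\hbar)^{-1/2}\,i^{m-1/2}\,|B|^{-1/2}\int e^{\frac i\hbar\mathcal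 A(x,x')}f(x')\,dx',\qquad \mathcal A(x,x')=\tfrac12DB^{-1}x^2-B^{-1}xx'+\tfrac12B^{-1}Ax'^2,$$ attached to the matrices $S=\begin{pmatrix}A&B\\C&D\end{pmatrix}\in \mathrm{SL}(2,\mathbb R)$ with $B\neq0$ ($m$ an even integer if $B>0$, odd if $B<0$); its covering projection onto $\mathrm{Sp}(1)=\mathrm{SL}(2,\mathbb R)$ is the homomorphism that sends $\widehat S_{\mathcal A,m}$ to $S$. (i) For every $(\mu,\nu)\ne(0,0)$, $W\psi$ is integrable along each line $\mu x+\nu p=X$, there are operators in $\mathrm{Mp}(1)$ that cover the rotation $U_{\mu,\nu}=\begin{pmatrix}\mu/\lambda&\nu/\lambda\\-\nu/\lambda&\mu/\lambda\end{pmatrix}$, and for any such operator $\widehat U_{\mu,\nu}$ the function $\widehat U_{\mu,\nu}\psi$ is continuous (after modification on a null set) and $$R(X,\mu,\nu)=\lambda^{-1}\,\bigl|\widehat U_{\mu,\nu}\psi(\lambda^{-1}X)\bigr|^2\qquad\text{for all }X\in\mathbb R .$$ (ii) The Wigner function is recovered by the inversion formula $$W\psi(x,p)=\frac1{(2\pi\hbar)^2}\int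 R(X,\mu,\nu)\,e^{\frac i\hbar(X-\mu x-\nu p)}\,dX\,d\mu\,d\nu,$$ understood as a Fourier transform of $R$: for every $(\mu,\nu)\neq(0,0)$ the function $X\mapsto R(X,\mu,\nu)$ is integrable; the function $G(\mu,\nu)=\int R(X,\mu,\nu)e^{iX/\hbar}\,dX$ belongs to $L^2(\mathbb R^2)$; for almost every $(x,p)$ the formula holds with the integral over $(\mu,\nu)$, namely $\int G(\mu,\nu)e^{-\frac i\hbar(\mu x+\nu p)}\,d\mu\,d\nu$, taken as the $L^2$ (Plancherel) Fourier transform of $G$; and if $G$ is integrable, the formula holds for every $(x,p)$ with this integral taken as a Lebesgue integral. -/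

import Mathlib

open MeasureTheory
open scoped FourierTransform ComplexConjugate

noncomputable section

namespace RadonWigner

/-- The complex Hilbert space `L²(ℝ)`. -/
abbrev L2R : Type := Lp ℂ 2 (volume : Measure ℝ)

/-- The Euclidean plane `ℝ²`, used for the variables `(x, p)` and for the dual
variables `(μ, ν)`. -/
abbrev Plane : Type := EuclideanSpace ℝ (Fin 2)

/-- The `ħ`-Fourier transform `ψ̂(p) = (2πħ)^{-1/2} ∫ e^{-ipx/ħ} ψ(x) dx`. -/
def hbarFourier (hbar : ℝ) (ψ : ℝ → ℂ) (p : ℝ) : ℂ :=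
  ((Real.sqrt (2 * Real.pi * hbar) : ℝ) : ℂ)⁻¹ *
    ∫ x : ℝ, Complex.exp (-(Complex.I * ((p * x / hbar : ℝ) : ℂ))) * ψ x

/-- The Wigner function
`Wψ(x,p) = (2πħ)⁻¹ ∫ e^{-ipy/ħ} ψ(x + y/2) conj(ψ(x - y/2)) dy`. -/
def wigner (hbar : ℝ) (ψ : ℝ → ℂ) (x p : ℝ) : ℂ :=
  ((2 * Real.pi * hbar : ℝ) : ℂ)⁻¹ *
    ∫ y : ℝ, Complex.exp (-(Complex.I * ((p * y / hbar : ℝ) : ℂ))) *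
      (ψ (x + y / 2) * conj (ψ (x - y / 2)))

/-- `λ = √(μ² + ν²)`. -/
def lam (μ ν : ℝ) : ℝ := Real.sqrt (μ ^ 2 + ν ^ 2)

/-- The distribution `δ(X - μx - νp)` on the `(x, p)`-plane, for `(μ, ν) ≠ (0, 0)`. It is the
measure `λ⁻¹ ds`, where `ds` is arc length on the line `μx + νp = X`; the line is parametrized
by `s ↦ U⁻¹(X/λ, s)`, with `U` the rotation `(x, p) ↦ λ⁻¹(μx + νp, -νx + μp)`. -/
def lineDelta (X μ ν : ℝ) : Measure (ℝ × ℝ) :=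
  ENNReal.ofReal (lam μ ν)⁻¹ •
    Measure.map
      (fun s : ℝ =>
        (μ / lam μ ν * (X / lam μ ν) - ν / lam μ ν * s,
         ν / lam μ ν * (X / lam μ ν) + μ / lam μ ν * s))
      volume

/-- The symplectic Radon transform of the Wigner function of `ψ`:
`R(X,μ,ν) = ∫ Wψ(x,p) δ(X - μx - νp) dp dx`. -/
def radon (hbar : ℝ) (ψ : ℝ → ℂ) (X μ ν : ℝ) : ℂ :=
  ∫ z : ℝ × ℝ, wigner hbar ψ z.1 z.2 ∂(lineDelta X μ ν)

/-- The generating function `½ D B⁻¹ x² - B⁻¹ x x' + ½ B⁻¹ A x'²` of a free matrix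
`S = (A, B; C, D)`. -/
def generatingFunction (S : Matrix.SpecialLinearGroup (Fin 2) ℝ) (x x' : ℝ) : ℝ :=
  S 1 1 / (2 * S 0 1) * x ^ 2 - x * x' / S 0 1 + S 0 0 / (2 * S 0 1) * x' ^ 2

/-- `T` is one of the quadratic Fourier transforms `Ŝ_{𝒜,m}` attached to the free symplectic
matrix `S = (A, B; C, D)`, `B ≠ 0`: the unitary operator on `L²(ℝ)` given on `L¹ ∩ L²` by
`Tf(x) = (2πħ)^{-1/2} i^{m-1/2} |B|^{-1/2} ∫ e^{(i/ħ)𝒜(x,x')} f(x') dx'`,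
where the integer `m` is even if `B > 0` and odd if `B < 0`. -/
def IsQuadraticFourier (hbar : ℝ) (T : L2R ≃ₗᵢ[ℂ] L2R)
    (S : Matrix.SpecialLinearGroup (Fin 2) ℝ) : Prop :=
  S 0 1 ≠ 0 ∧ ∃ m : ℤ, (Even m ↔ 0 < S 0 1) ∧
    ∀ f : L2R, Integrable (fun x => f x) →
      ∀ᵐ x : ℝ, T f x =
        ((Real.sqrt (2 * Real.pi * hbar) : ℝ) : ℂ)⁻¹ *
          Complex.exp (Complex.I * ((Real.pi / 2 * ((m : ℝ) - 1 / 2) : ℝ) : ℂ)) *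
          ((Real.sqrt |(S 0 1)⁻¹| : ℝ) : ℂ) *
          ∫ x' : ℝ, Complex.exp (Complex.I * ((generatingFunction S x x' / hbar : ℝ) : ℂ)) * f x'

/-- The metaplectic group `Mp(1)` together with its covering projection onto
`Sp(1) = SL(2, ℝ)`, given as the graph of that projection: the group of pairs `(T, S)` generated
by the quadratic Fourier transforms paired with their free symplectic matrices. -/
def metaplecticGraph (hbar : ℝ) :
    Subgroup ((L2R ≃ₗᵢ[ℂ] L2R) × Matrix.SpecialLinearGroup (Fin 2) ℝ) :=
  Subgroup.closure {q | IsQuadraticFourier hbar q.1 q.2}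

/-- `T` is a metaplectic operator which covers the symplectic matrix `S`. -/
def Covers (hbar : ℝ) (T : L2R ≃ₗᵢ[ℂ] L2R) (S : Matrix.SpecialLinearGroup (Fin 2) ℝ) : Prop :=
  (T, S) ∈ metaplecticGraph hbar

theorem lam_sq (μ ν : ℝ) : lam μ ν * lam μ ν = μ ^ 2 + ν ^ 2 :=
  Real.mul_self_sqrt (by positivity)

theorem lam_ne_zero {μ ν : ℝ} (h : (μ, ν) ≠ (0, 0)) : lam μ ν ≠ 0 := by
  intro h0
  have h1 := lam_sq μ ν
  rw [h0] at h1
  have hμ : μ = 0 := by nlinarith [sq_nonneg μ, sq_nonneg ν]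
  have hν : ν = 0 := by nlinarith [sq_nonneg μ, sq_nonneg ν]
  exact h (by rw [hμ, hν])

/-- The rotation `U_{μ,ν} = (μ/λ, ν/λ; -ν/λ, μ/λ)`. -/
def rotation (μ ν : ℝ) (h : (μ, ν) ≠ (0, 0)) : Matrix.SpecialLinearGroup (Fin 2) ℝ :=
  ⟨!![μ / lam μ ν, ν / lam μ ν; -ν / lam μ ν, μ / lam μ ν], by
    have h1 := lam_sq μ ν
    have h2 := lam_ne_zero h
    rw [Matrix.det_fin_two_of]
    field_simp
    nlinarith⟩

/-- The Fourier transform of `R(·,μ,ν)` in the variable `X`, at the frequency occurring in the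
inversion formula: `G(μ,ν) = ∫ R(X,μ,ν) e^{iX/ħ} dX`. -/
def radonFourier (hbar : ℝ) (ψ : ℝ → ℂ) (w : Plane) : ℂ :=
  ∫ X : ℝ, radon hbar ψ X (w 0) (w 1) * Complex.exp (Complex.I * ((X / hbar : ℝ) : ℂ))

/-- The Plancherel (`L²`) version of the Fourier transform
`(x,p) ↦ ∫ G(μ,ν) e^{-(i/ħ)(μx + νp)} dμ dν`. Mathlib's transform `𝓕` on `L²` has the kernel
`e^{-2πi⟨w,z⟩}`, which is why its argument is rescaled by `(2πħ)⁻¹`. -/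
def planeFourierL2 (hbar : ℝ) (G : Lp ℂ 2 (volume : Measure Plane)) (z : Plane) : ℂ :=
  (𝓕 G : Lp ℂ 2 (volume : Measure Plane)) ((2 * Real.pi * hbar)⁻¹ • z)

end RadonWigner

end

/-!
The proof rests on the Grossmann–Royer reflections `Π(z)f(u) = e^{2ip(u - x)/ħ} f(2x - u)`,
`z = (x, p)`, through which both phase-space transforms of `f` are matrix coefficients: the Wigner
function is `(πħ)⁻¹⟨f, Π(z)f⟩` (`wigner_eq_inner_reflOp`), and the ambiguity function
`A(μ, ν) = ∫ e^{iμx/ħ} f(x + ν/2) conj f(x - ν/2) dx` is `⟨f, Π(z)Π(0)f⟩` with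
`z = (-ν/2, μ/2)` (`ambiguity_eq_inner`). The pairs `(T, S)` with `T Π(z) = Π(Sz) T` form a group
`covariantGraph`. A quadratic Fourier transform and its matrix satisfy this relation by an identity
of generating functions and a change of the integration variable, so every metaplectic operator
does (`Covers.mem_covariantGraph`). Hence `W(Tψ)(Sz) = Wψ(z)`, and likewise for `A`. Conversely a
quadratic Fourier transform exists over each free matrix, built from Mathlib's Plancherel transform
and two chirps, which yields operators over all rotations (`exists_covers_rotation`).

For (i), covariance turns the integral of `Wψ` over a line into the integral of `Wφ(X/λ, ·)` with
`φ = Uψ`, and the latter is the position marginal `|φ(X/λ)|²` by Fourier inversion at `y = 0`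
(`integral_wigner_eq_norm_sq`). This needs two facts. First, `Wψ` is integrable on lines: it is
dominated by an integrable function of `x`, and, by covariance under the quarter turn, by an
integrable function of `p`. Second, `φ` has a continuous version: for one particular operator over
the rotation this is visible from its formula, and any other one yields the same function up to a
constant phase, because the Wigner function determines `f ⊗ conj f`
(`exists_phase_of_wigner_eq`). The function `ψ` itself may be taken continuous, since it has an
integrable Fourier transform.

For (ii), (i) gives `G(μ, ν) = ∫ |φ(x)|² e^{iλx/ħ} dx`, the ambiguity function of `φ` at `(λ, 0)`,
which by covariance is that of `ψ` at `(μ, ν)` (`radonFourier_eq_ambiguity`). The Wigner and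
ambiguity functions are partial Fourier transforms of one kernel
`ψ(x + y/2) conj ψ(x - y/2)`, in `y` and in `x` respectively. Plancherel in `x` shows that
`A ∈ L²(ℝ²)`; inversion in `μ` alone followed by the integral over `|ν| ≤ n` shows that the
truncations of `A` have Fourier integrals converging pointwise to a multiple of `Wψ`, and they
converge to `A` in `L²` (`planeFourierL2_ambiguity`). If `A` is integrable, no truncation is
needed.
-/

noncomputable section

namespace RadonWigner

/-! ### The Plancherel transform on `L¹ ∩ L²` -/

section Plancherel

variable {V : Type*} [NormedAddCommGroup V] [InnerProductSpace ℝ V] [FiniteDimensional ℝ V]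
  [MeasurableSpace V] [BorelSpace V]

theorem continuous_fourier_of_integrable {f : V → ℂ} (hf : Integrable f) : Continuous (𝓕 f) :=
  VectorFourier.fourierIntegral_continuous Real.continuous_fourierChar
    (by exact continuous_inner) hf

theorem continuous_fourierInv_of_integrable {f : V → ℂ} (hf : Integrable f) :
    Continuous (𝓕⁻ f) := by
  have : 𝓕⁻ f = fun x => 𝓕 f (-x) := funext fun x => Real.fourierInv_eq_fourier_neg f x
  rw [this]
  exact (continuous_fourier_of_integrable hf).comp continuous_neg

/-- On `L¹ ∩ L²` the Plancherel transform is the Fourier integral: both define the same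
tempered distribution. -/
theorem fourier_toLp_ae_eq {f : V → ℂ} (hf1 : Integrable f) (hf2 : MemLp f 2) :
    (𝓕 (hf2.toLp f) : Lp ℂ 2 (volume : Measure V)) =ᵐ[volume] 𝓕 f := by
  refine ae_eq_of_integral_contDiff_smul_eq
    ((Lp.memLp _).locallyIntegrable (by norm_num))
    (continuous_fourier_of_integrable hf1).locallyIntegrable ?_
  intro g hg hgc
  have hg' : ContDiff ℝ (⊤ : ℕ∞) (fun x => (g x : ℂ)) := Complex.ofRealCLM.contDiff.comp hg
  have hgc' : HasCompactSupport (fun x => (g x : ℂ)) := hgc.comp_left Complex.ofReal_zero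
  set θ : SchwartzMap V ℂ := hgc'.toSchwartzMap hg' with hθ
  have h1 := congrArg (fun D : TemperedDistribution V ℂ => D θ)
    (Lp.fourier_toTemperedDistribution_eq (hf2.toLp f))
  simp only [TemperedDistribution.fourier_apply, Lp.toTemperedDistribution_apply] at h1
  have h2 : ∫ x, (𝓕 θ : SchwartzMap V ℂ) x • (hf2.toLp f) x = ∫ x, 𝓕 (θ : V → ℂ) x • f x := by
    refine integral_congr_ae ?_
    filter_upwards [hf2.coeFn_toLp] with x hx
    rw [hx, SchwartzMap.fourier_coe]
  have h3 : ∫ x, 𝓕 (θ : V → ℂ) x • f x = ∫ x, θ x • 𝓕 f x := by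
    have h := VectorFourier.integral_fourierIntegral_smul_eq_flip (f := (θ : V → ℂ)) (g := f)
      (μ := volume) (ν := volume) (L := innerₗ V) Real.continuous_fourierChar
      (by exact continuous_inner) θ.integrable hf1
    rw [flip_innerₗ] at h
    exact h
  rw [h2, h3] at h1
  exact h1.symm

/-- On `L¹ ∩ L²` the inverse Plancherel transform is the inverse Fourier integral. -/
theorem fourierInv_toLp_ae_eq {f : V → ℂ} (hf1 : Integrable f) (hf2 : MemLp f 2) :
    (𝓕⁻ (hf2.toLp f) : Lp ℂ 2 (volume : Measure V)) =ᵐ[volume] 𝓕⁻ f := by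
  refine ae_eq_of_integral_contDiff_smul_eq
    ((Lp.memLp _).locallyIntegrable (by norm_num))
    (continuous_fourierInv_of_integrable hf1).locallyIntegrable ?_
  intro g hg hgc
  have hg' : ContDiff ℝ (⊤ : ℕ∞) (fun x => (g x : ℂ)) := Complex.ofRealCLM.contDiff.comp hg
  have hgc' : HasCompactSupport (fun x => (g x : ℂ)) := hgc.comp_left Complex.ofReal_zero
  set θ : SchwartzMap V ℂ := hgc'.toSchwartzMap hg' with hθ
  have h1 := congrArg (fun D : TemperedDistribution V ℂ => D θ)
    (Lp.fourierInv_toTemperedDistribution_eq (hf2.toLp f))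
  simp only [TemperedDistribution.fourierInv_apply, Lp.toTemperedDistribution_apply] at h1
  have h2 : ∫ x, (𝓕⁻ θ : SchwartzMap V ℂ) x • (hf2.toLp f) x = ∫ x, 𝓕⁻ (θ : V → ℂ) x • f x := by
    refine integral_congr_ae ?_
    filter_upwards [hf2.coeFn_toLp] with x hx
    rw [hx, SchwartzMap.fourierInv_coe]
  have h3 : ∫ x, 𝓕⁻ (θ : V → ℂ) x • f x = ∫ x, θ x • 𝓕⁻ f x := by
    have h := VectorFourier.integral_fourierIntegral_smul_eq_flip (f := (θ : V → ℂ)) (g := f)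
      (μ := volume) (ν := volume) (L := -innerₗ V) Real.continuous_fourierChar
      (by exact continuous_inner.neg) θ.integrable hf1
    have h4 : (-innerₗ V).flip = -innerₗ V := by
      ext x y; simp [real_inner_comm]
    rw [h4] at h
    exact h
  rw [h2, h3] at h1
  exact h1.symm

theorem memLp_fourier {f : V → ℂ} (hf1 : Integrable f) (hf2 : MemLp f 2) : MemLp (𝓕 f) 2 :=
  (memLp_congr_ae (fourier_toLp_ae_eq hf1 hf2)).1 (Lp.memLp _)

theorem eLpNorm_fourier {f : V → ℂ} (hf1 : Integrable f) (hf2 : MemLp f 2) :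
    eLpNorm (𝓕 f) 2 = eLpNorm f 2 := by
  rw [← eLpNorm_congr_ae (fourier_toLp_ae_eq hf1 hf2), ← Lp.enorm_def, ← ofReal_norm,
    Lp.norm_fourier_eq, ofReal_norm, Lp.enorm_def, eLpNorm_congr_ae hf2.coeFn_toLp]

/-- Fourier inversion almost everywhere, without a continuity assumption. -/
theorem fourierInv_fourier_ae_eq {f : V → ℂ} (hf1 : Integrable f) (hf2 : MemLp f 2)
    (hF : Integrable (𝓕 f)) : 𝓕⁻ (𝓕 f) =ᵐ[volume] f := by
  have h1 := fourierInv_toLp_ae_eq hF (memLp_fourier hf1 hf2)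
  have h2 : (memLp_fourier hf1 hf2).toLp (𝓕 f) = 𝓕 (hf2.toLp f) := by
    refine Lp.ext ?_
    exact (MemLp.coeFn_toLp _).trans (fourier_toLp_ae_eq hf1 hf2).symm
  rw [h2, FourierTransform.fourierInv_fourier_eq] at h1
  exact h1.symm.trans hf2.coeFn_toLp

/-- The Fourier integral is injective on `L¹ ∩ L²`. -/
theorem ae_eq_of_fourier_eq {f g : V → ℂ} (hf1 : Integrable f) (hf2 : MemLp f 2)
    (hg1 : Integrable g) (hg2 : MemLp g 2) (h : 𝓕 f = 𝓕 g) : f =ᵐ[volume] g := by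
  have h1 : 𝓕 (hf2.toLp f) = 𝓕 (hg2.toLp g) := by
    refine Lp.ext ((fourier_toLp_ae_eq hf1 hf2).trans ?_)
    rw [h]
    exact (fourier_toLp_ae_eq hg1 hg2).symm
  have h2 : hf2.toLp f = hg2.toLp g := (Lp.fourierTransformₗᵢ V ℂ).injective h1
  exact (MemLp.toLp_eq_toLp_iff _ _).1 h2

end Plancherel

/-! ### Weighted affine substitutions as isometries of `L²(ℝ)` -/

section WeightedComposition

theorem quasiMeasurePreserving_affine {a : ℝ} (ha : a ≠ 0) (b : ℝ) :
    Measure.QuasiMeasurePreserving (fun x : ℝ => a * x + b) volume volume := by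
  have h1 : Measure.QuasiMeasurePreserving (fun x : ℝ => a * x) volume volume := by
    refine ⟨measurable_const_mul a, ?_⟩
    rw [Real.map_volume_mul_left ha]
    exact Measure.smul_absolutelyContinuous
  exact (measurePreserving_add_right volume b).quasiMeasurePreserving.comp h1

theorem map_affine_volume {a : ℝ} (ha : a ≠ 0) (b : ℝ) :
    Measure.map (fun x : ℝ => a * x + b) volume = ENNReal.ofReal |a⁻¹| • volume := by
  have h : (fun x : ℝ => a * x + b) = (fun x => x + b) ∘ fun x => a * x := rfl
  rw [h, ← Measure.map_map (measurable_add_const b) (measurable_const_mul a),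
    Real.map_volume_mul_left ha, Measure.map_smul, (measurePreserving_add_right volume b).map_eq]

theorem eLpNorm_weightedComp {w : ℝ → ℂ} {a : ℝ} (ha : a ≠ 0) (b : ℝ)
    (hn : ∀ x, ‖w x‖ = √|a|) {f : ℝ → ℂ} (hf : AEStronglyMeasurable f) :
    eLpNorm (fun x => w x * f (a * x + b)) 2 = eLpNorm f 2 := by
  have h1 : eLpNorm (fun x => w x * f (a * x + b)) 2
      = eLpNorm (((√|a| : ℝ) : ℂ) • (f ∘ fun x => a * x + b)) 2 := by
    refine eLpNorm_congr_norm_ae (Filter.Eventually.of_forall fun x => ?_)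
    simp [hn, abs_of_nonneg (Real.sqrt_nonneg |a|)]
  have hm : Measure.map (fun x : ℝ => a * x + b) volume ≪ volume :=
    (quasiMeasurePreserving_affine ha b).absolutelyContinuous
  rw [h1, eLpNorm_const_smul, ← eLpNorm_map_measure (hf.mono_ac hm) (by fun_prop),
    map_affine_volume ha b, eLpNorm_smul_measure_of_ne_top (by norm_num), smul_eq_mul, ← mul_assoc]
  have h2 : ‖((√|a| : ℝ) : ℂ)‖ₑ * ENNReal.ofReal |a⁻¹| ^ (1 / (2 : ENNReal)).toReal = 1 := by
    have h3 : (1 / (2 : ENNReal)).toReal = 1 / 2 := by simp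
    rw [h3, ENNReal.ofReal_rpow_of_nonneg (abs_nonneg _) (by norm_num), ← Real.sqrt_eq_rpow,
      ← ofReal_norm, ← ENNReal.ofReal_mul (norm_nonneg _), Complex.norm_real,
      Real.norm_of_nonneg (Real.sqrt_nonneg _), ← Real.sqrt_mul (abs_nonneg _), ← abs_mul,
      mul_inv_cancel₀ ha]
    simp
  rw [h2, one_mul]

theorem memLp_weightedComp {w : ℝ → ℂ} (hw : Continuous w) {a : ℝ} (ha : a ≠ 0) (b : ℝ)
    (hn : ∀ x, ‖w x‖ = √|a|) {f : ℝ → ℂ} (hf : MemLp f 2) :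
    MemLp (fun x => w x * f (a * x + b)) 2 :=
  ⟨hw.aestronglyMeasurable.mul
      (hf.1.comp_quasiMeasurePreserving (quasiMeasurePreserving_affine ha b)), by
    rw [eLpNorm_weightedComp ha b hn hf.1]; exact hf.2⟩

/-- The isometry `f ↦ w(x) f(ax + b)` of `L²(ℝ)`, for a continuous weight with `|w| = √|a|`.
Dilations, chirp multiplications and point reflections with modulation are all of this form. -/
def weightedComp (w : ℝ → ℂ) (hw : Continuous w) (a b : ℝ) (ha : a ≠ 0)
    (hn : ∀ x, ‖w x‖ = √|a|) : L2R →ₗᵢ[ℂ] L2R where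
  toFun f := (memLp_weightedComp hw ha b hn (Lp.memLp f)).toLp _
  map_add' f g := by
    rw [← MemLp.toLp_add]
    refine MemLp.toLp_congr _ _ ?_
    filter_upwards [(quasiMeasurePreserving_affine ha b).ae (Lp.coeFn_add f g)] with x hx
    simp only [Pi.add_apply] at hx ⊢
    rw [hx, mul_add]
  map_smul' c f := by
    rw [RingHom.id_apply, ← MemLp.toLp_const_smul]
    refine MemLp.toLp_congr _ _ ?_
    filter_upwards [(quasiMeasurePreserving_affine ha b).ae (Lp.coeFn_smul c f)] with x hx
    simp only [Pi.smul_apply, smul_eq_mul] at hx ⊢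
    rw [hx]; ring
  norm_map' f := by
    simp only [LinearMap.coe_mk, AddHom.coe_mk]
    rw [Lp.norm_toLp, eLpNorm_weightedComp ha b hn (Lp.aestronglyMeasurable f), Lp.norm_def]

theorem weightedComp_ae (w : ℝ → ℂ) (hw : Continuous w) (a b : ℝ) (ha : a ≠ 0)
    (hn : ∀ x, ‖w x‖ = √|a|) (f : L2R) :
    weightedComp w hw a b ha hn f =ᵐ[volume] fun x => w x * f (a * x + b) :=
  MemLp.coeFn_toLp (memLp_weightedComp hw ha b hn (Lp.memLp f))

theorem weightedComp_surjective (w : ℝ → ℂ) (hw : Continuous w) (a b : ℝ) (ha : a ≠ 0)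
    (hn : ∀ x, ‖w x‖ = √|a|) : Function.Surjective (weightedComp w hw a b ha hn) := by
  intro g
  have hw0 : ∀ x, w x ≠ 0 := fun x => by
    rw [← norm_pos_iff, hn]; exact Real.sqrt_pos.2 (abs_pos.2 ha)
  -- The preimage is again a weighted substitution, along `x ↦ (x - b)/a`.
  let f := weightedComp (fun x => (w (a⁻¹ * x + -(b / a)))⁻¹)
    ((hw.comp (by fun_prop)).inv₀ fun x => hw0 _) a⁻¹ (-(b / a)) (inv_ne_zero ha)
    (fun x => by rw [norm_inv, hn, abs_inv, Real.sqrt_inv]) g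
  refine ⟨f, Lp.ext ?_⟩
  filter_upwards [weightedComp_ae w hw a b ha hn f,
    (quasiMeasurePreserving_affine ha b).ae (weightedComp_ae (fun x => (w (a⁻¹ * x + -(b / a)))⁻¹)
      ((hw.comp (by fun_prop)).inv₀ fun x => hw0 _) a⁻¹ (-(b / a)) (inv_ne_zero ha)
      (fun x => by rw [norm_inv, hn, abs_inv, Real.sqrt_inv]) g)] with x h1 h2
  rw [h1, h2]
  have h3 : a⁻¹ * (a * x + b) + -(b / a) = x := by field_simp; ring
  rw [h3, mul_inv_cancel_left₀ (hw0 x)]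

/-- The unitary operator `f ↦ w(x) f(ax + b)` of `L²(ℝ)`. -/
def weightedCompEquiv (w : ℝ → ℂ) (hw : Continuous w) (a b : ℝ) (ha : a ≠ 0)
    (hn : ∀ x, ‖w x‖ = √|a|) : L2R ≃ₗᵢ[ℂ] L2R :=
  LinearIsometryEquiv.ofSurjective (weightedComp w hw a b ha hn)
    (weightedComp_surjective w hw a b ha hn)

end WeightedComposition

theorem norm_exp_I_mul_ofReal (t : ℝ) : ‖Complex.exp (Complex.I * (t : ℂ))‖ = 1 := by
  rw [mul_comm]; exact Complex.norm_exp_ofReal_mul_I t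

/-! ### Grossmann–Royer reflections and the Wigner function -/

section Reflection

/-- The Grossmann–Royer reflection operator at the point `z = (x, p)` of phase space,
`Π(z) f(u) = e^{2ip(u - x)/ħ} f(2x - u)`. Up to a constant, `⟨f, Π(z) f⟩` is the Wigner function
of `f` at `z`. -/
def reflOp (hbar : ℝ) (z : Fin 2 → ℝ) : L2R →ₗᵢ[ℂ] L2R :=
  weightedComp (fun u => Complex.exp (Complex.I * ((2 * z 1 * (u - z 0) / hbar : ℝ) : ℂ)))
    (by fun_prop) (-1) (2 * z 0) (by norm_num)
    (fun u => by rw [norm_exp_I_mul_ofReal]; simp)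

theorem reflOp_ae (hbar : ℝ) (z : Fin 2 → ℝ) (f : L2R) :
    reflOp hbar z f =ᵐ[volume] fun u =>
      Complex.exp (Complex.I * ((2 * z 1 * (u - z 0) / hbar : ℝ) : ℂ)) * f (-1 * u + 2 * z 0) :=
  weightedComp_ae _ _ _ _ _ _ f

theorem wigner_congr_ae {hbar : ℝ} {f g : ℝ → ℂ} (h : f =ᵐ[volume] g) :
    wigner hbar f = wigner hbar g := by
  ext x p
  unfold wigner
  congr 1
  refine integral_congr_ae ?_
  have h1 := (quasiMeasurePreserving_affine (a := 1 / 2) (by norm_num) x).ae h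
  have h2 := (quasiMeasurePreserving_affine (a := -(1 / 2)) (by norm_num) x).ae h
  filter_upwards [h1, h2] with y h1 h2
  rw [show x + y / 2 = 1 / 2 * y + x by ring, show x - y / 2 = -(1 / 2) * y + x by ring, h1, h2]

/-- The Wigner function is a matrix coefficient of the reflections, by the substitution
`y = 2(x - u)` in its definition. -/
theorem wigner_eq_inner_reflOp {hbar : ℝ} (f : L2R) (z : Fin 2 → ℝ) :
    wigner hbar f (z 0) (z 1) = ((Real.pi * hbar : ℝ) : ℂ)⁻¹ * inner ℂ f (reflOp hbar z f) := by
  have h1 : inner ℂ f (reflOp hbar z f) = ∫ u : ℝ,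
      Complex.exp (Complex.I * ((2 * z 1 * (u - z 0) / hbar : ℝ) : ℂ)) * f (2 * z 0 - u)
        * conj (f u) := by
    rw [L2.inner_def]
    refine integral_congr_ae ?_
    filter_upwards [reflOp_ae hbar z f] with u hu
    rw [hu, RCLike.inner_apply, show -1 * u + 2 * z 0 = 2 * z 0 - u by ring]
  rw [h1]
  unfold wigner
  set F : ℝ → ℂ := fun y => Complex.exp (-(Complex.I * ((z 1 * y / hbar : ℝ) : ℂ))) *
    (f (z 0 + y / 2) * conj (f (z 0 - y / 2)))
  have h2 : ∫ u : ℝ, Complex.exp (Complex.I * ((2 * z 1 * (u - z 0) / hbar : ℝ) : ℂ))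
      * f (2 * z 0 - u) * conj (f u) = ∫ u : ℝ, F (2 * (z 0 - u)) := by
    refine integral_congr_ae (Filter.Eventually.of_forall fun u => ?_)
    simp only [F]
    rw [show z 0 + 2 * (z 0 - u) / 2 = 2 * z 0 - u by ring,
      show z 0 - 2 * (z 0 - u) / 2 = u by ring, mul_assoc]
    congr 2
    push_cast; ring
  rw [h2, integral_sub_left_eq_self (fun u => F (2 * u)) volume (z 0),
    Measure.integral_comp_mul_left F 2, abs_of_pos (by norm_num : (0 : ℝ) < 2⁻¹)]
  rw [Complex.real_smul]
  push_cast
  rw [mul_inv, mul_inv, mul_inv]; ring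

end Reflection

/-! ### The group of covariant pairs -/

section Covariance

/-- The pairs `(T, S)` with `T Π(z) = Π(Sz) T` for all points `z` of phase space. -/
def covariantGraph (hbar : ℝ) :
    Subgroup ((L2R ≃ₗᵢ[ℂ] L2R) × Matrix.SpecialLinearGroup (Fin 2) ℝ) where
  carrier := {q | ∀ (z : Fin 2 → ℝ) (f : L2R),
    q.1 (reflOp hbar z f) = reflOp hbar ((q.2 : Matrix (Fin 2) (Fin 2) ℝ).mulVec z) (q.1 f)}
  mul_mem' := by
    intro q r hq hr z f
    change q.1 (r.1 (reflOp hbar z f)) = reflOp hbar _ (q.1 (r.1 f))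
    rw [hr, hq, Matrix.mulVec_mulVec]
    rfl
  one_mem' := by
    intro z f
    simp
  inv_mem' := by
    intro q hq z f
    change q.1.symm (reflOp hbar z f) = reflOp hbar _ (q.1.symm f)
    rw [LinearIsometryEquiv.symm_apply_eq, hq, LinearIsometryEquiv.apply_symm_apply,
      Matrix.mulVec_mulVec]
    change _ = reflOp hbar (((q.2 * (q.2)⁻¹ : Matrix.SpecialLinearGroup (Fin 2) ℝ) :
      Matrix (Fin 2) (Fin 2) ℝ).mulVec z) f
    rw [mul_inv_cancel]
    simp

end Covariance

/-! ### Quadratic Fourier transforms -/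

section QuadraticFourier

theorem sl_two_det (S : Matrix.SpecialLinearGroup (Fin 2) ℝ) :
    S 0 0 * S 1 1 - S 0 1 * S 1 0 = 1 := by
  have := S.det_coe
  rwa [Matrix.det_fin_two] at this

/-- The phase identity which makes quadratic Fourier transforms covariant: reflecting the
integration variable of the generating function at `z` amounts to reflecting the output variable
at `S z`. -/
theorem generatingFunction_reflection (S : Matrix.SpecialLinearGroup (Fin 2) ℝ)
    (hB : S 0 1 ≠ 0) (x₀ p₀ x x' : ℝ) :
    generatingFunction S x (2 * x₀ - x') + 2 * p₀ * (x₀ - x') =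
      2 * (S 1 0 * x₀ + S 1 1 * p₀) * (x - (S 0 0 * x₀ + S 0 1 * p₀)) +
        generatingFunction S (2 * (S 0 0 * x₀ + S 0 1 * p₀) - x) x' := by
  have hd : S 1 0 = (S 0 0 * S 1 1 - 1) / S 0 1 := by
    field_simp
    linarith [sl_two_det S]
  rw [hd]
  unfold generatingFunction
  field_simp
  ring

theorem integrable_weightedComp {w : ℝ → ℂ} (hw : Continuous w) {a : ℝ} (ha : a ≠ 0) (b : ℝ)
    (hn : ∀ x, ‖w x‖ = √|a|) {f : ℝ → ℂ} (hf : Integrable f) :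
    Integrable (fun x => w x * f (a * x + b)) := by
  have h : Integrable (fun x => f (a * x + b)) :=
    (hf.comp_add_right b).comp_mul_left' ha
  refine h.bdd_mul (c := √|a|) hw.aestronglyMeasurable ?_
  exact Filter.Eventually.of_forall fun x => (hn x).le

/-- Covariance on integrable functions, where the operator is given by its integral kernel. -/
theorem IsQuadraticFourier.apply_reflOp_of_integrable {hbar : ℝ} {T : L2R ≃ₗᵢ[ℂ] L2R}
    {S : Matrix.SpecialLinearGroup (Fin 2) ℝ} (h : IsQuadraticFourier hbar T S)
    (z : Fin 2 → ℝ) (f : L2R) (hf : Integrable (fun x => f x)) :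
    T (reflOp hbar z f) =
      reflOp hbar ((S : Matrix (Fin 2) (Fin 2) ℝ).mulVec z) (T f) := by
  obtain ⟨hB, m, -, hT⟩ := h
  have hR : Integrable (fun x => reflOp hbar z f x) := by
    rw [integrable_congr (reflOp_ae hbar z f)]
    exact integrable_weightedComp (by fun_prop) (by norm_num) _
      (fun u => by rw [norm_exp_I_mul_ofReal]; simp) hf
  refine Lp.ext ?_
  set y : Fin 2 → ℝ := (S : Matrix (Fin 2) (Fin 2) ℝ).mulVec z with hy
  have hy0 : y 0 = S 0 0 * z 0 + S 0 1 * z 1 := by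
    simp [hy]
  have hy1 : y 1 = S 1 0 * z 0 + S 1 1 * z 1 := by
    simp [hy]
  filter_upwards [hT _ hR, reflOp_ae hbar y (T f),
    (quasiMeasurePreserving_affine (a := -1) (by norm_num) (2 * y 0)).ae (hT f hf)] with x h1 h2 h3
  rw [h1, h2, h3]
  have h4 : ∫ x' : ℝ, Complex.exp (Complex.I * ((generatingFunction S x x' / hbar : ℝ) : ℂ)) *
      reflOp hbar z f x' = Complex.exp (Complex.I * ((2 * y 1 * (x - y 0) / hbar : ℝ) : ℂ)) *
      ∫ x' : ℝ, Complex.exp (Complex.I *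
        ((generatingFunction S (-1 * x + 2 * y 0) x' / hbar : ℝ) : ℂ)) * f x' := by
    rw [← integral_const_mul]
    have h5 : ∫ x' : ℝ, Complex.exp (Complex.I * ((generatingFunction S x x' / hbar : ℝ) : ℂ)) *
        reflOp hbar z f x' =
        ∫ x' : ℝ, Complex.exp (Complex.I * ((generatingFunction S x x' / hbar : ℝ) : ℂ)) *
        (Complex.exp (Complex.I * ((2 * z 1 * (x' - z 0) / hbar : ℝ) : ℂ)) *
          f (2 * z 0 - x')) := by
      refine integral_congr_ae ?_
      filter_upwards [reflOp_ae hbar z f] with x' hx'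
      rw [hx', show -1 * x' + 2 * z 0 = 2 * z 0 - x' by ring]
    rw [h5, ← integral_sub_left_eq_self _ volume (2 * z 0)]
    refine integral_congr_ae (Filter.Eventually.of_forall fun x' => ?_)
    simp only
    rw [show 2 * z 0 - (2 * z 0 - x') = x' by ring, ← mul_assoc, ← mul_assoc, ← Complex.exp_add,
      ← Complex.exp_add, ← mul_add, ← mul_add, ← Complex.ofReal_add, ← Complex.ofReal_add,
      ← add_div, ← add_div, show 2 * z 1 * (2 * z 0 - x' - z 0) = 2 * z 1 * (z 0 - x') by ring,
      generatingFunction_reflection S hB, ← hy0, ← hy1,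
      show -1 * x + 2 * y 0 = 2 * y 0 - x by ring]
  rw [h4]
  ring

theorem IsQuadraticFourier.mem_covariantGraph {hbar : ℝ} {T : L2R ≃ₗᵢ[ℂ] L2R}
    {S : Matrix.SpecialLinearGroup (Fin 2) ℝ} (h : IsQuadraticFourier hbar T S) :
    (T, S) ∈ covariantGraph hbar := by
  intro z f
  refine DenseRange.induction_on (p := fun f : L2R => T (reflOp hbar z f) =
      reflOp hbar ((S : Matrix (Fin 2) (Fin 2) ℝ).mulVec z) (T f))
    (SchwartzMap.denseRange_toLpCLM (E := ℝ) (F := ℂ) (μ := volume) (p := 2) (by norm_num)) f ?_ ?_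
  · exact isClosed_eq (T.continuous.comp (reflOp hbar z).continuous)
      ((reflOp hbar _).continuous.comp T.continuous)
  · intro θ
    refine h.apply_reflOp_of_integrable z _ ?_
    exact (integrable_congr (θ.coeFn_toLp 2 volume)).2 θ.integrable

/-- Covariance passes from the generators to the whole metaplectic group. -/
theorem Covers.mem_covariantGraph {hbar : ℝ} {T : L2R ≃ₗᵢ[ℂ] L2R}
    {S : Matrix.SpecialLinearGroup (Fin 2) ℝ} (h : Covers hbar T S) :
    (T, S) ∈ covariantGraph hbar := by
  have : metaplecticGraph hbar ≤ covariantGraph hbar :=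
    (Subgroup.closure_le _).2 fun q hq => hq.mem_covariantGraph
  exact this h

/-- Every free symplectic matrix carries a quadratic Fourier transform: the composition of the
Plancherel transform with a chirp before and a dilated chirp after. -/
theorem exists_isQuadraticFourier {hbar : ℝ} (hbar_pos : 0 < hbar)
    (S : Matrix.SpecialLinearGroup (Fin 2) ℝ) (hB : S 0 1 ≠ 0) :
    ∃ T : L2R ≃ₗᵢ[ℂ] L2R, IsQuadraticFourier hbar T S := by
  obtain ⟨m, hm⟩ : ∃ m : ℤ, (Even m ↔ 0 < S 0 1) := by
    by_cases h : 0 < S 0 1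
    · exact ⟨0, by simp [h]⟩
    · exact ⟨1, by simp [h]⟩
  have hπ : 0 < 2 * Real.pi * hbar := by positivity
  have ha : (2 * Real.pi * hbar * S 0 1)⁻¹ ≠ 0 := inv_ne_zero (mul_ne_zero hπ.ne' hB)
  -- `w₁` is applied after the Plancherel transform, `w₂` before it; the dilation by `(2πħB)⁻¹`
  -- turns the kernel `e^{-2πixx'}` into `e^{-ixx'/(ħB)}`.
  let w₁ : ℝ → ℂ := fun x => ((Real.sqrt (2 * Real.pi * hbar) : ℝ) : ℂ)⁻¹ *
    Complex.exp (Complex.I * ((Real.pi / 2 * ((m : ℝ) - 1 / 2) : ℝ) : ℂ)) *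
    ((Real.sqrt |(S 0 1)⁻¹| : ℝ) : ℂ) *
    Complex.exp (Complex.I * ((S 1 1 / (2 * S 0 1) * x ^ 2 / hbar : ℝ) : ℂ))
  have hw₁ : Continuous w₁ := by fun_prop
  have hn₁ : ∀ x, ‖w₁ x‖ = √|(2 * Real.pi * hbar * S 0 1)⁻¹| := by
    intro x
    simp only [w₁, norm_mul, norm_inv, norm_exp_I_mul_ofReal, Complex.norm_real, mul_one,
      Real.norm_of_nonneg (Real.sqrt_nonneg _)]
    rw [mul_inv, abs_mul, Real.sqrt_mul (abs_nonneg _), abs_of_pos (inv_pos.2 hπ),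
      Real.sqrt_inv (2 * Real.pi * hbar)]
  let w₂ : ℝ → ℂ := fun x =>
    Complex.exp (Complex.I * ((S 0 0 / (2 * S 0 1) * x ^ 2 / hbar : ℝ) : ℂ))
  have hw₂ : Continuous w₂ := by fun_prop
  have hn₂ : ∀ x, ‖w₂ x‖ = √|1| := by
    intro x
    simp only [w₂, norm_exp_I_mul_ofReal, abs_one, Real.sqrt_one]
  let T : L2R ≃ₗᵢ[ℂ] L2R := (weightedCompEquiv w₂ hw₂ 1 0 one_ne_zero hn₂).trans
    ((Lp.fourierTransformₗᵢ ℝ ℂ).trans (weightedCompEquiv w₁ hw₁ _ 0 ha hn₁))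
  refine ⟨T, hB, m, hm, fun f hf => ?_⟩
  set g := weightedComp w₂ hw₂ 1 0 one_ne_zero hn₂ f with hg
  have hT : T f = weightedComp w₁ hw₁ _ 0 ha hn₁ (𝓕 g) := rfl
  have hg1 : Integrable (fun x => g x) := by
    rw [integrable_congr (weightedComp_ae w₂ hw₂ 1 0 one_ne_zero hn₂ f)]
    exact integrable_weightedComp hw₂ one_ne_zero 0 hn₂ hf
  have hgF := fourier_toLp_ae_eq hg1 (Lp.memLp g)
  rw [Lp.toLp_coeFn] at hgF
  rw [hT]
  filter_upwards [weightedComp_ae w₁ hw₁ _ 0 ha hn₁ (𝓕 g),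
    (quasiMeasurePreserving_affine ha 0).ae hgF] with x h1 h2
  rw [h1, h2, Real.fourier_real_eq_integral_exp_smul]
  simp only [w₁]
  rw [mul_assoc _ (Complex.exp _) (∫ _, _), ← integral_const_mul]
  congr 1
  refine integral_congr_ae ?_
  filter_upwards [weightedComp_ae w₂ hw₂ 1 0 one_ne_zero hn₂ f] with x' hx'
  rw [hx', one_mul, add_zero, add_zero, smul_eq_mul]
  simp only [w₂]
  rw [← mul_assoc, ← mul_assoc, ← Complex.exp_add, ← Complex.exp_add]
  congr 2
  unfold generatingFunction
  have hB' : ((S 0 1 : ℝ) : ℂ) ≠ 0 := by exact_mod_cast hB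
  have hh : (hbar : ℂ) ≠ 0 := by exact_mod_cast hbar_pos.ne'
  have hpi : (Real.pi : ℂ) ≠ 0 := by exact_mod_cast Real.pi_ne_zero
  push_cast
  field_simp
  ring

end QuadraticFourier

/-! ### Metaplectic operators over rotations -/

section Rotations

variable {μ ν : ℝ}

/-- Each rotation is covered by a metaplectic operator; for `ν = 0` the rotation is `±1`, and `-1`
is the square of the free matrix `(0, 1; -1, 0)`. -/
theorem exists_covers_rotation {hbar : ℝ} (hbar_pos : 0 < hbar) (h : (μ, ν) ≠ (0, 0)) :
    ∃ T : L2R ≃ₗᵢ[ℂ] L2R, Covers hbar T (rotation μ ν h) := by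
  by_cases hν : ν = 0
  · subst hν
    have hμ : μ ≠ 0 := fun hμ => h (by rw [hμ])
    have hl : lam μ 0 = |μ| := by simp [lam, Real.sqrt_sq_eq_abs]
    rcases lt_or_gt_of_ne hμ with hneg | hpos
    · have h01 : ((0 : ℝ), (1 : ℝ)) ≠ (0, 0) := by simp
      have hl1 : lam 0 1 = 1 := by simp [lam]
      obtain ⟨J, hJ⟩ := exists_isQuadraticFourier hbar_pos (rotation 0 1 h01)
        (by simp [rotation, hl1])
      refine ⟨J * J, ?_⟩
      have hJ' : (J, rotation 0 1 h01) ∈ metaplecticGraph hbar := Subgroup.subset_closure hJ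
      have h2 := mul_mem hJ' hJ'
      have h3 : rotation 0 1 h01 * rotation 0 1 h01 = rotation μ 0 h := by
        ext i j
        rw [Matrix.SpecialLinearGroup.coe_mul, Matrix.mul_apply, Fin.sum_univ_two]
        fin_cases i <;> fin_cases j <;>
          simp [rotation, hl1, hl, abs_of_neg hneg, hμ, div_neg]
      rw [Prod.mk_mul_mk, h3] at h2
      exact h2
    · refine ⟨1, ?_⟩
      have h3 : rotation μ 0 h = 1 := by
        ext i j
        fin_cases i <;> fin_cases j <;>
          simp [rotation, hl, abs_of_pos hpos, hμ]
      rw [h3]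
      exact one_mem (metaplecticGraph hbar)
  · obtain ⟨T, hT⟩ := exists_isQuadraticFourier hbar_pos (rotation μ ν h)
      (by simpa [rotation] using ⟨hν, lam_ne_zero h⟩)
    exact ⟨T, Subgroup.subset_closure hT⟩

end Rotations

/-! ### The correlation kernel and the ambiguity function -/

section Correlation

/-- The substitution `(x, y) ↦ (x + y/2, x - y/2)` preserves area, being a composition of shears and
a swap. -/
theorem measurePreserving_sum_diff :
    MeasurePreserving (fun z : ℝ × ℝ => (z.1 + z.2 / 2, z.1 - z.2 / 2))
      (volume.prod volume) (volume.prod volume) := by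
  have h1 : MeasurePreserving (fun z : ℝ × ℝ => (z.1, z.2 + z.1 / 2))
      (volume.prod volume) (volume.prod volume) :=
    (MeasurePreserving.id volume).skew_product (g := fun y x : ℝ => x + y / 2) (by fun_prop)
      (Filter.Eventually.of_forall fun y => (measurePreserving_add_right volume (y / 2)).map_eq)
  have h2 : MeasurePreserving (fun z : ℝ × ℝ => (z.1, z.1 - z.2))
      (volume.prod volume) (volume.prod volume) :=
    (MeasurePreserving.id volume).skew_product (g := fun a y : ℝ => a - y) (by fun_prop)
      (Filter.Eventually.of_forall fun a => (Measure.measurePreserving_sub_left volume a).map_eq)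
  have h3 := h2.comp (Measure.measurePreserving_swap.comp
    (h1.comp Measure.measurePreserving_swap))
  convert h3 using 1
  ext z
  · simp
  · simp only [Function.comp, Prod.swap]; ring

/-- The inverse substitution `(a, b) ↦ ((a + b)/2, a - b)` preserves area. -/
theorem measurePreserving_mean_diff :
    MeasurePreserving (fun z : ℝ × ℝ => ((z.1 + z.2) / 2, z.1 - z.2))
      (volume.prod volume) (volume.prod volume) := by
  have h1 : MeasurePreserving (fun z : ℝ × ℝ => (z.1, z.2 - z.1 / 2))
      (volume.prod volume) (volume.prod volume) :=
    (MeasurePreserving.id volume).skew_product (g := fun y a : ℝ => a - y / 2) (by fun_prop)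
      (Filter.Eventually.of_forall fun y => (measurePreserving_sub_right volume (y / 2)).map_eq)
  have h2 : MeasurePreserving (fun z : ℝ × ℝ => (z.1, z.1 - z.2))
      (volume.prod volume) (volume.prod volume) :=
    (MeasurePreserving.id volume).skew_product (g := fun a y : ℝ => a - y) (by fun_prop)
      (Filter.Eventually.of_forall fun a => (Measure.measurePreserving_sub_left volume a).map_eq)
  have h3 := (Measure.measurePreserving_swap.comp h1).comp
    (Measure.measurePreserving_swap.comp h2)
  convert h3 using 1
  ext z
  · simp only [Function.comp, Prod.swap]; ring
  · simp

/-- The correlation kernel `(x, y) ↦ ψ(x + y/2) conj ψ(x - y/2)`. The Wigner function is its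
Fourier transform in `y`, the ambiguity function its inverse Fourier transform in `x`. -/
def corr (ψ : ℝ → ℂ) (x y : ℝ) : ℂ := ψ (x + y / 2) * conj (ψ (x - y / 2))

variable {ψ : ℝ → ℂ}

theorem memLp_conj {p : ENNReal} (h : MemLp ψ p) : MemLp (fun x => conj (ψ x)) p :=
  h.star

theorem integrable_conj (h : Integrable ψ) : Integrable (fun x => conj (ψ x)) := by
  rw [← memLp_one_iff_integrable] at h ⊢
  exact memLp_conj h

theorem integrable_corr_prod (h : Integrable ψ) :
    Integrable (fun z : ℝ × ℝ => corr ψ z.1 z.2) (volume.prod volume) :=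
  measurePreserving_sum_diff.integrable_comp_of_integrable (h.mul_prod (integrable_conj h))

theorem memLp_corr_prod (h : MemLp ψ 2) :
    MemLp (fun z : ℝ × ℝ => corr ψ z.1 z.2) 2 (volume.prod volume) := by
  have h0 : MemLp (fun z : ℝ × ℝ => ψ z.1 * conj (ψ z.2)) 2 (volume.prod volume) := by
    have h0 : AEStronglyMeasurable (fun z : ℝ × ℝ => ψ z.1 * conj (ψ z.2)) (volume.prod volume) :=
      h.1.comp_fst.mul h.1.comp_snd.star
    rw [memLp_two_iff_integrable_sq_norm h0]
    have h1 := (memLp_two_iff_integrable_sq_norm h.1).1 h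
    refine (h1.mul_prod h1).congr (Filter.Eventually.of_forall fun z => ?_)
    simp [mul_pow]
  exact h0.comp_measurePreserving measurePreserving_sum_diff

theorem integrable_corr_right (h : MemLp ψ 2) (x : ℝ) : Integrable (fun y => corr ψ x y) := by
  have h1 : MemLp (fun y : ℝ => ψ (x + y)) 2 :=
    h.comp_measurePreserving (measurePreserving_add_left volume x)
  have h2 : MemLp (fun y : ℝ => conj (ψ (x - y))) 2 :=
    (memLp_conj h).comp_measurePreserving (Measure.measurePreserving_sub_left volume x)
  exact (h1.integrable_mul h2).comp_div (g := fun y => ψ (x + y) * conj (ψ (x - y)))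
    (by norm_num : (2 : ℝ) ≠ 0)

theorem integrable_corr_left (h : MemLp ψ 2) (y : ℝ) : Integrable (fun x => corr ψ x y) := by
  have h1 : MemLp (fun x : ℝ => ψ (x + y / 2)) 2 :=
    h.comp_measurePreserving (measurePreserving_add_right volume _)
  have h2 : MemLp (fun x : ℝ => conj (ψ (x - y / 2))) 2 :=
    (memLp_conj h).comp_measurePreserving (measurePreserving_sub_right volume _)
  exact h1.integrable_mul h2

theorem ae_memLp_corr_right (h : MemLp ψ 2) : ∀ᵐ x : ℝ, MemLp (fun y => corr ψ x y) 2 := by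
  have h1 := (memLp_two_iff_integrable_sq_norm (memLp_corr_prod h).1).1 (memLp_corr_prod h)
  filter_upwards [h1.prod_right_ae] with x hx
  exact (memLp_two_iff_integrable_sq_norm (integrable_corr_right h x).1).2 hx

theorem ae_memLp_corr_left (h : MemLp ψ 2) : ∀ᵐ y : ℝ, MemLp (fun x => corr ψ x y) 2 := by
  have h1 := (memLp_two_iff_integrable_sq_norm (memLp_corr_prod h).1).1 (memLp_corr_prod h)
  filter_upwards [h1.prod_left_ae] with y hy
  exact (memLp_two_iff_integrable_sq_norm (integrable_corr_left h y).1).2 hy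

theorem wigner_eq_fourier_corr {hbar : ℝ} (hbar_pos : 0 < hbar) (ψ : ℝ → ℂ) (x p : ℝ) :
    wigner hbar ψ x p = ((2 * Real.pi * hbar : ℝ) : ℂ)⁻¹ *
      𝓕 (fun y => corr ψ x y) ((2 * Real.pi * hbar)⁻¹ * p) := by
  unfold wigner
  rw [Real.fourier_real_eq_integral_exp_smul]
  congr 1
  refine integral_congr_ae (Filter.Eventually.of_forall fun y => ?_)
  simp only [corr, smul_eq_mul]
  congr 2
  have hh : (hbar : ℂ) ≠ 0 := by exact_mod_cast hbar_pos.ne'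
  have hpi : (Real.pi : ℂ) ≠ 0 := by exact_mod_cast Real.pi_ne_zero
  push_cast
  field_simp

/-- The ambiguity function `A(μ, ν) = ∫ e^{iμx/ħ} ψ(x + ν/2) conj ψ(x - ν/2) dx`. -/
def ambiguity (hbar : ℝ) (ψ : ℝ → ℂ) (μ ν : ℝ) : ℂ :=
  ∫ x : ℝ, Complex.exp (Complex.I * ((μ * x / hbar : ℝ) : ℂ)) * corr ψ x ν

theorem ambiguity_eq_fourier_corr {hbar : ℝ} (hbar_pos : 0 < hbar) (ψ : ℝ → ℂ) (μ ν : ℝ) :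
    ambiguity hbar ψ μ ν = 𝓕 (fun x => corr ψ x ν) (-(2 * Real.pi * hbar)⁻¹ * μ) := by
  unfold ambiguity
  rw [Real.fourier_real_eq_integral_exp_smul]
  refine integral_congr_ae (Filter.Eventually.of_forall fun y => ?_)
  simp only [smul_eq_mul]
  congr 2
  have hh : (hbar : ℂ) ≠ 0 := by exact_mod_cast hbar_pos.ne'
  have hpi : (Real.pi : ℂ) ≠ 0 := by exact_mod_cast Real.pi_ne_zero
  push_cast
  field_simp

theorem ambiguity_congr_ae {hbar : ℝ} {f g : ℝ → ℂ} (h : f =ᵐ[volume] g) :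
    ambiguity hbar f = ambiguity hbar g := by
  ext μ ν
  unfold ambiguity corr
  refine integral_congr_ae ?_
  have h1 := (measurePreserving_add_right volume (ν / 2)).quasiMeasurePreserving.ae h
  have h2 := (measurePreserving_sub_right volume (ν / 2)).quasiMeasurePreserving.ae h
  filter_upwards [h1, h2] with y h1 h2
  rw [h1, h2]

end Correlation

/-! ### Covariance of the Wigner and ambiguity functions -/

section CovarianceOfTransforms

variable {hbar : ℝ} {T : L2R ≃ₗᵢ[ℂ] L2R} {S : Matrix.SpecialLinearGroup (Fin 2) ℝ}

theorem wigner_covariant (h : (T, S) ∈ covariantGraph hbar) (f : L2R) (z : Fin 2 → ℝ) :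
    wigner hbar (T f) ((S : Matrix (Fin 2) (Fin 2) ℝ).mulVec z 0)
      ((S : Matrix (Fin 2) (Fin 2) ℝ).mulVec z 1) = wigner hbar f (z 0) (z 1) := by
  rw [wigner_eq_inner_reflOp, wigner_eq_inner_reflOp, ← h z f]
  rw [LinearIsometryEquiv.inner_map_map]

/-- The product of two reflections is a phase-space translation, so that the ambiguity function
is a matrix coefficient of such a product. -/
theorem ambiguity_eq_inner (f : L2R) (z : Fin 2 → ℝ) :
    ambiguity hbar f (2 * z 1) (-2 * z 0) =
      inner ℂ f (reflOp hbar z (reflOp hbar 0 f)) := by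
  rw [L2.inner_def]
  have h2 : ∀ᵐ u : ℝ, reflOp hbar z (reflOp hbar 0 f) u =
      Complex.exp (Complex.I * ((2 * z 1 * (u - z 0) / hbar : ℝ) : ℂ)) * f (u - 2 * z 0) := by
    filter_upwards [reflOp_ae hbar z (reflOp hbar 0 f),
      (quasiMeasurePreserving_affine (a := -1) (by norm_num) (2 * z 0)).ae
        (reflOp_ae hbar 0 f)] with u h1 h2
    rw [h1, h2]
    simp only [Pi.zero_apply, mul_zero, zero_mul, zero_div, Complex.ofReal_zero, Complex.exp_zero,
      one_mul, add_zero]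
    congr 2; ring
  have h3 : ∫ u : ℝ, inner ℂ (f u) (reflOp hbar z (reflOp hbar 0 f) u) =
      ∫ u : ℝ, Complex.exp (Complex.I * ((2 * z 1 * (u - z 0) / hbar : ℝ) : ℂ)) *
        f (u - 2 * z 0) * conj (f u) := by
    refine integral_congr_ae ?_
    filter_upwards [h2] with u hu
    rw [hu, RCLike.inner_apply]
  rw [h3, ← integral_add_right_eq_self _ (z 0)]
  unfold ambiguity corr
  refine integral_congr_ae (Filter.Eventually.of_forall fun u => ?_)
  simp only
  rw [show u + -2 * z 0 / 2 = u + z 0 - 2 * z 0 by ring, show u - -2 * z 0 / 2 = u + z 0 by ring,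
    show u + z 0 - z 0 = u by ring, mul_assoc (Complex.exp _)]

theorem ambiguity_covariant (h : (T, S) ∈ covariantGraph hbar) (f : L2R) (z : Fin 2 → ℝ) :
    ambiguity hbar (T f) (2 * (S : Matrix (Fin 2) (Fin 2) ℝ).mulVec z 1)
      (-2 * (S : Matrix (Fin 2) (Fin 2) ℝ).mulVec z 0) =
      ambiguity hbar f (2 * z 1) (-2 * z 0) := by
  have h0 := h 0 f
  simp only [Matrix.mulVec_zero] at h0
  rw [ambiguity_eq_inner, ambiguity_eq_inner, ← h0, ← h z, LinearIsometryEquiv.inner_map_map]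

end CovarianceOfTransforms

/-! ### The Wigner function determines the phase class -/

section Phase

/-- The Wigner function determines an `L²` function up to a constant phase: by injectivity of the
Fourier transform in `y` it determines `f ⊗ conj f` almost everywhere. -/
theorem exists_phase_of_wigner_eq {hbar : ℝ} (hbar_pos : 0 < hbar) {f g : L2R}
    (h : ∀ x p, wigner hbar f x p = wigner hbar g x p) (hn : ‖f‖ = ‖g‖) :
    ∃ c : ℂ, ‖c‖ = 1 ∧ ∀ᵐ x : ℝ, f x = c * g x := by
  by_cases hf : f = 0
  · have hg : g = 0 := by rw [← norm_eq_zero, ← hn, hf, norm_zero]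
    refine ⟨1, norm_one, ?_⟩
    rw [hf, hg]
    simp
  have hπ : 0 < 2 * Real.pi * hbar := by positivity
  have hF : ∀ x, 𝓕 (fun y => corr f x y) = 𝓕 (fun y => corr g x y) := by
    intro x
    ext t
    have h1 := h x (2 * Real.pi * hbar * t)
    rw [wigner_eq_fourier_corr hbar_pos, wigner_eq_fourier_corr hbar_pos,
      inv_mul_cancel_left₀ hπ.ne'] at h1
    exact mul_left_cancel₀ (inv_ne_zero (by exact_mod_cast hπ.ne')) h1
  have hf2 := Lp.memLp f
  have hg2 := Lp.memLp g
  have h1 : ∀ᵐ x : ℝ, ∀ᵐ y : ℝ, corr f x y = corr g x y := by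
    filter_upwards [ae_memLp_corr_right hf2, ae_memLp_corr_right hg2] with x h1 h2
    exact ae_eq_of_fourier_eq (integrable_corr_right hf2 x) h1 (integrable_corr_right hg2 x) h2
      (hF x)
  have hm : ∀ u : L2R, Measurable (fun z : ℝ × ℝ => corr u z.1 z.2) := by
    intro u
    have hu := (Lp.stronglyMeasurable u).measurable
    exact (hu.comp (by fun_prop)).mul
      (Complex.continuous_conj.measurable.comp (hu.comp (by fun_prop)))
  have h2 : ∀ᵐ z : ℝ × ℝ ∂(volume.prod volume), corr f z.1 z.2 = corr g z.1 z.2 :=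
    (Measure.ae_prod_iff_ae_ae (measurableSet_eq_fun (hm f) (hm g))).2 h1
  have h3 : ∀ᵐ a : ℝ, ∀ᵐ b : ℝ, f a * conj (f b) = g a * conj (g b) := by
    refine Measure.ae_ae_of_ae_prod (p := fun z : ℝ × ℝ =>
      f z.1 * conj (f z.2) = g z.1 * conj (g z.2)) ?_
    filter_upwards [measurePreserving_mean_diff.quasiMeasurePreserving.ae h2] with z hz
    simp only [corr] at hz
    rwa [show (z.1 + z.2) / 2 + (z.1 - z.2) / 2 = z.1 by ring,
      show (z.1 + z.2) / 2 - (z.1 - z.2) / 2 = z.2 by ring] at hz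
  -- Freezing one variable where `f` does not vanish exhibits `f` as a multiple of `g`.
  obtain ⟨a, ha0, ha⟩ : ∃ a, f a ≠ 0 ∧ ∀ᵐ b : ℝ, f a * conj (f b) = g a * conj (g b) := by
    by_contra hcon
    refine hf ((Lp.eq_zero_iff_ae_eq_zero).2 ?_)
    filter_upwards [h3] with a ha
    by_contra h0
    exact hcon ⟨a, h0, ha⟩
  have hc : ∀ᵐ b : ℝ, f b = conj (g a / f a) * g b := by
    filter_upwards [ha] with b hb
    have h4 : conj (f b) = g a / f a * conj (g b) := by
      field_simp
      linear_combination hb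
    have h5 := congrArg conj h4
    simpa using h5
  refine ⟨_, ?_, hc⟩
  have h6 : f = conj (g a / f a) • g := by
    refine Lp.ext ?_
    filter_upwards [hc, Lp.coeFn_smul (conj (g a / f a)) g] with b hb hb'
    rw [hb, hb', Pi.smul_apply, smul_eq_mul]
  have h7 : ‖f‖ = ‖conj (g a / f a)‖ * ‖f‖ := by
    conv_lhs => rw [h6]
    rw [norm_smul, hn]
  have h8 : ‖f‖ ≠ 0 := norm_ne_zero_iff.2 hf
  exact (mul_eq_right₀ h8).1 h7.symm

end Phase

/-! ### Bounds and measurability -/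

section Bounds

variable {hbar : ℝ} {ψ : ℝ → ℂ}

theorem norm_exp_neg_I_mul_ofReal (t : ℝ) : ‖Complex.exp (-(Complex.I * (t : ℂ)))‖ = 1 := by
  rw [Complex.exp_neg, norm_inv, norm_exp_I_mul_ofReal, inv_one]

theorem norm_wigner_le (hbar_pos : 0 < hbar) (ψ : ℝ → ℂ) (x p : ℝ) :
    ‖wigner hbar ψ x p‖ ≤ (2 * Real.pi * hbar)⁻¹ * ∫ y : ℝ, ‖corr ψ x y‖ := by
  have hπ : 0 < 2 * Real.pi * hbar := by positivity
  unfold wigner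
  rw [norm_mul, norm_inv, Complex.norm_real, Real.norm_of_nonneg hπ.le]
  refine mul_le_mul_of_nonneg_left ((norm_integral_le_integral_norm _).trans ?_) (by positivity)
  refine le_of_eq (integral_congr_ae (Filter.Eventually.of_forall fun y => ?_))
  simp only [norm_mul, norm_exp_neg_I_mul_ofReal, one_mul, corr]

theorem norm_ambiguity_le (hbar : ℝ) (ψ : ℝ → ℂ) (μ ν : ℝ) :
    ‖ambiguity hbar ψ μ ν‖ ≤ ∫ x : ℝ, ‖corr ψ x ν‖ := by
  refine (norm_integral_le_integral_norm _).trans ?_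
  refine le_of_eq (integral_congr_ae (Filter.Eventually.of_forall fun y => ?_))
  simp only [norm_mul, norm_exp_I_mul_ofReal, one_mul]

theorem stronglyMeasurable_wigner (hψ : Continuous ψ) :
    StronglyMeasurable (fun z : ℝ × ℝ => wigner hbar ψ z.1 z.2) := by
  unfold wigner
  refine StronglyMeasurable.const_mul (StronglyMeasurable.integral_prod_right
    (f := fun (z : ℝ × ℝ) (y : ℝ) => Complex.exp (-(Complex.I * ((z.2 * y / hbar : ℝ) : ℂ))) *
      (ψ (z.1 + y / 2) * conj (ψ (z.1 - y / 2)))) ?_) _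
  exact Continuous.stronglyMeasurable (by fun_prop)

theorem stronglyMeasurable_ambiguity (hψ : Continuous ψ) :
    StronglyMeasurable (fun z : ℝ × ℝ => ambiguity hbar ψ z.1 z.2) := by
  unfold ambiguity corr
  refine StronglyMeasurable.integral_prod_right
    (f := fun (z : ℝ × ℝ) (x : ℝ) => Complex.exp (Complex.I * ((z.1 * x / hbar : ℝ) : ℂ)) *
      (ψ (x + z.2 / 2) * conj (ψ (x - z.2 / 2)))) ?_
  exact Continuous.stronglyMeasurable (by fun_prop)

theorem rotation_mulVec {μ ν : ℝ} (h : (μ, ν) ≠ (0, 0)) (z : Fin 2 → ℝ) :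
    (rotation μ ν h : Matrix (Fin 2) (Fin 2) ℝ).mulVec z =
      ![μ / lam μ ν * z 0 + ν / lam μ ν * z 1, -ν / lam μ ν * z 0 + μ / lam μ ν * z 1] := by
  ext i
  fin_cases i <;> simp [rotation, Matrix.mulVec, dotProduct, Fin.sum_univ_two]

theorem lam_zero_one : lam 0 1 = 1 := by simp [lam]

/-- The operator `J` over the quarter turn is, up to a phase, the `ħ`-Fourier transform, so that `Jψ`
is integrable. -/
theorem exists_covariant_quarterTurn (hbar_pos : 0 < hbar) (hψ1 : Integrable ψ)
    (hψ2 : MemLp ψ 2) (hF1 : Integrable (hbarFourier hbar ψ)) :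
    ∃ J : L2R ≃ₗᵢ[ℂ] L2R, (J, rotation 0 1 (by simp)) ∈ covariantGraph hbar ∧
      Integrable (fun x => J (hψ2.toLp ψ) x) := by
  obtain ⟨J, hJ⟩ := exists_isQuadraticFourier hbar_pos (rotation 0 1 (by simp))
    (by simp [rotation, lam_zero_one])
  refine ⟨J, hJ.mem_covariantGraph, ?_⟩
  obtain ⟨-, m, -, hJ⟩ := hJ
  have h1 := hJ (hψ2.toLp ψ) ((integrable_congr hψ2.coeFn_toLp).2 hψ1)
  refine (hF1.const_mul
    (Complex.exp (Complex.I * ((Real.pi / 2 * ((m : ℝ) - 1 / 2) : ℝ) : ℂ)))).congr ?_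
  filter_upwards [h1] with x hx
  have h2 : ∫ x' : ℝ, Complex.exp (Complex.I * ((generatingFunction
      (rotation 0 1 (by simp)) x x' / hbar : ℝ) : ℂ)) * hψ2.toLp ψ x' =
      ∫ x' : ℝ, Complex.exp (-(Complex.I * ((x * x' / hbar : ℝ) : ℂ))) * ψ x' := by
    refine integral_congr_ae ?_
    filter_upwards [hψ2.coeFn_toLp] with x' hx'
    rw [hx']
    congr 2
    simp [generatingFunction, rotation, lam_zero_one]
    ring
  rw [hx, h2]
  unfold hbarFourier
  simp [rotation, lam_zero_one]
  ring

end Bounds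

/-! ### Continuous representatives -/

section ContinuousRepresentative

variable {hbar : ℝ} {ψ : ℝ → ℂ}

/-- The parity operator `f ↦ f(-x)`. -/
def parity : L2R ≃ₗᵢ[ℂ] L2R :=
  weightedCompEquiv (fun _ => 1) continuous_const (-1) 0 (by norm_num) (by simp)

theorem parity_ae (f : L2R) : parity f =ᵐ[volume] fun x => f (-x) := by
  filter_upwards [weightedComp_ae (fun _ => 1) continuous_const (-1) 0 (by norm_num) (by simp) f]
    with x hx
  change weightedComp (fun _ => 1) continuous_const (-1) 0 (by norm_num) (by simp) f x = _
  rw [hx, one_mul, add_zero, neg_one_mul]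

theorem parity_mem_covariantGraph (hbar : ℝ) : (parity, -1) ∈ covariantGraph hbar := by
  intro z f
  refine Lp.ext ?_
  have hq := quasiMeasurePreserving_affine (a := -1) (by norm_num)
  filter_upwards [parity_ae (reflOp hbar z f), (hq 0).ae (reflOp_ae hbar z f),
    reflOp_ae hbar (((-1 : Matrix.SpecialLinearGroup (Fin 2) ℝ) :
      Matrix (Fin 2) (Fin 2) ℝ).mulVec z) (parity f),
    (hq (2 * -z 0)).ae (parity_ae f)] with u h1 h2 h3 h4
  have hz : ((-1 : Matrix.SpecialLinearGroup (Fin 2) ℝ) : Matrix (Fin 2) (Fin 2) ℝ).mulVec z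
      = -z := by
    rw [Matrix.SpecialLinearGroup.coe_neg, Matrix.SpecialLinearGroup.coe_one, Matrix.neg_mulVec,
      Matrix.one_mulVec]
  simp only [hz, Pi.neg_apply] at h3 ⊢
  rw [h1, h3, h4]
  rw [neg_one_mul, add_zero] at h2
  rw [h2]
  congr 2
  · congr 2; ring_nf
  · ring

/-- A quadratic Fourier transform of an integrable function has a continuous representative,
the defining integral. -/
theorem IsQuadraticFourier.exists_continuous_ae {T : L2R ≃ₗᵢ[ℂ] L2R}
    {S : Matrix.SpecialLinearGroup (Fin 2) ℝ} (h : IsQuadraticFourier hbar T S) {f : L2R}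
    (hf : Integrable (fun x => f x)) :
    ∃ φ : ℝ → ℂ, Continuous φ ∧ ∀ᵐ x : ℝ, T f x = φ x := by
  obtain ⟨-, m, -, hT⟩ := h
  refine ⟨_, ?_, hT f hf⟩
  refine continuous_const.mul (continuous_of_dominated (bound := fun x' => ‖f x'‖) ?_ ?_ hf.norm ?_)
  · intro x
    refine AEStronglyMeasurable.mul (Continuous.aestronglyMeasurable ?_) hf.1
    unfold generatingFunction
    fun_prop
  · intro x
    refine Filter.Eventually.of_forall fun x' => ?_
    rw [norm_mul, norm_exp_I_mul_ofReal, one_mul]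
  · refine Filter.Eventually.of_forall fun x' => ?_
    unfold generatingFunction
    fun_prop

/-- Over each rotation there is one operator whose effect on `ψ` is explicit: a quadratic Fourier
transform if `ν ≠ 0`, and the identity or the parity operator if `ν = 0`. -/
theorem exists_covariant_continuous_ae (hbar_pos : 0 < hbar) (hψ : Continuous ψ)
    (hψ1 : Integrable ψ) (hψ2 : MemLp ψ 2) {μ ν : ℝ} (h : (μ, ν) ≠ (0, 0)) :
    ∃ T : L2R ≃ₗᵢ[ℂ] L2R, (T, rotation μ ν h) ∈ covariantGraph hbar ∧
      ∃ φ : ℝ → ℂ, Continuous φ ∧ ∀ᵐ x : ℝ, T (hψ2.toLp ψ) x = φ x := by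
  by_cases hν : ν = 0
  · subst hν
    have hμ : μ ≠ 0 := fun hμ => h (by rw [hμ])
    have hl : lam μ 0 = |μ| := by simp [lam, Real.sqrt_sq_eq_abs]
    rcases lt_or_gt_of_ne hμ with hneg | hpos
    · refine ⟨parity, ?_, fun x => ψ (-x), by fun_prop, ?_⟩
      · have h3 : rotation μ 0 h = -1 := by
          ext i j
          fin_cases i <;> fin_cases j <;>
            simp [rotation, hl, abs_of_neg hneg, hμ, div_neg]
        rw [h3]
        exact parity_mem_covariantGraph hbar
      · filter_upwards [parity_ae (hψ2.toLp ψ),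
          (Measure.measurePreserving_neg (volume : Measure ℝ)).quasiMeasurePreserving.ae
            hψ2.coeFn_toLp] with x h1 h2
        rw [h1, h2]
    · refine ⟨1, ?_, ψ, hψ, hψ2.coeFn_toLp⟩
      have h3 : rotation μ 0 h = 1 := by
        ext i j
        fin_cases i <;> fin_cases j <;>
          simp [rotation, hl, abs_of_pos hpos, hμ]
      rw [h3]
      exact one_mem (covariantGraph hbar)
  · obtain ⟨T, hT⟩ := exists_isQuadraticFourier hbar_pos (rotation μ ν h)
      (by simpa [rotation] using ⟨hν, lam_ne_zero h⟩)
    exact ⟨T, hT.mem_covariantGraph,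
      hT.exists_continuous_ae ((integrable_congr hψ2.coeFn_toLp).2 hψ1)⟩

/-- Two operators covariant over the same matrix agree up to a phase on each function, so
continuity of the image does not depend on the operator chosen. -/
theorem exists_continuous_ae (hbar_pos : 0 < hbar) (hψ : Continuous ψ)
    (hψ1 : Integrable ψ) (hψ2 : MemLp ψ 2) {μ ν : ℝ} (h : (μ, ν) ≠ (0, 0))
    {T : L2R ≃ₗᵢ[ℂ] L2R} (hT : (T, rotation μ ν h) ∈ covariantGraph hbar) :
    ∃ φ : ℝ → ℂ, Continuous φ ∧ ∀ᵐ x : ℝ, T (hψ2.toLp ψ) x = φ x := by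
  obtain ⟨T', hT', φ, hφ, hae⟩ := exists_covariant_continuous_ae hbar_pos hψ hψ1 hψ2 h
  have hW : ∀ x p, wigner hbar (T (hψ2.toLp ψ)) x p = wigner hbar (T' (hψ2.toLp ψ)) x p := by
    intro x p
    have hz : (rotation μ ν h : Matrix (Fin 2) (Fin 2) ℝ).mulVec
        ((((rotation μ ν h)⁻¹ : Matrix.SpecialLinearGroup (Fin 2) ℝ) :
          Matrix (Fin 2) (Fin 2) ℝ).mulVec ![x, p]) = ![x, p] := by
      rw [Matrix.mulVec_mulVec, ← Matrix.SpecialLinearGroup.coe_mul, mul_inv_cancel,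
        Matrix.SpecialLinearGroup.coe_one, Matrix.one_mulVec]
    have h1 := wigner_covariant hT (hψ2.toLp ψ)
      ((((rotation μ ν h)⁻¹ : Matrix.SpecialLinearGroup (Fin 2) ℝ) :
          Matrix (Fin 2) (Fin 2) ℝ).mulVec ![x, p])
    have h2 := wigner_covariant hT' (hψ2.toLp ψ)
      ((((rotation μ ν h)⁻¹ : Matrix.SpecialLinearGroup (Fin 2) ℝ) :
          Matrix (Fin 2) (Fin 2) ℝ).mulVec ![x, p])
    rw [hz] at h1 h2
    exact h1.trans h2.symm
  obtain ⟨c, -, hc⟩ := exists_phase_of_wigner_eq hbar_pos hW (by simp)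
  refine ⟨fun x => c * φ x, by fun_prop, ?_⟩
  filter_upwards [hc, hae] with x h1 h2
  rw [h1, h2]

end ContinuousRepresentative

/-! ### Integrals of the Wigner function over lines -/

section Lines

variable {hbar : ℝ} {ψ : ℝ → ℂ}

/-- The point with parameter `s` on the line `μx + νp = X`, the preimage of `(X/λ, s)` under the
rotation. -/
def linePoint (X μ ν s : ℝ) : ℝ × ℝ :=
  (μ / lam μ ν * (X / lam μ ν) - ν / lam μ ν * s, ν / lam μ ν * (X / lam μ ν) + μ / lam μ ν * s)

theorem continuous_linePoint (X μ ν : ℝ) : Continuous (linePoint X μ ν) := by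
  unfold linePoint; fun_prop

theorem rotation_mulVec_linePoint {μ ν : ℝ} (h : (μ, ν) ≠ (0, 0)) (X s : ℝ) :
    (rotation μ ν h : Matrix (Fin 2) (Fin 2) ℝ).mulVec
      ![(linePoint X μ ν s).1, (linePoint X μ ν s).2] = ![X / lam μ ν, s] := by
  have h1 := lam_sq μ ν
  have h2 := lam_ne_zero h
  have h3 : (μ / lam μ ν) ^ 2 + (ν / lam μ ν) ^ 2 = 1 := by
    field_simp
    linarith
  rw [rotation_mulVec]
  simp only [Matrix.cons_val_zero, Matrix.cons_val_one, linePoint]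
  rw [neg_div]
  congr 1
  · linear_combination (X / lam μ ν) * h3
  · congr 1
    linear_combination s * h3

theorem lineDelta_eq (X μ ν : ℝ) : lineDelta X μ ν =
    ENNReal.ofReal (lam μ ν)⁻¹ • Measure.map (linePoint X μ ν) volume := rfl

/-- The Wigner function is dominated by an integrable function of `x` alone and by an integrable
function of `p` alone. The first settles all lines on which `x` varies, the second the lines
`x = const`. -/
theorem integrable_wigner_linePoint (hbar_pos : 0 < hbar) (hψ : Continuous ψ)
    (hψ1 : Integrable ψ) (hψ2 : MemLp ψ 2) (hF1 : Integrable (hbarFourier hbar ψ))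
    {μ ν : ℝ} (h : (μ, ν) ≠ (0, 0)) (X : ℝ) :
    Integrable (fun s => wigner hbar ψ (linePoint X μ ν s).1 (linePoint X μ ν s).2) := by
  have hm : AEStronglyMeasurable
      (fun s => wigner hbar ψ (linePoint X μ ν s).1 (linePoint X μ ν s).2) volume :=
    ((stronglyMeasurable_wigner hψ).comp_measurable
      (continuous_linePoint X μ ν).measurable).aestronglyMeasurable
  have hl := lam_ne_zero h
  by_cases hν : ν = 0
  · have hμ : μ ≠ 0 := fun hμ => h (by rw [hμ, hν])
    obtain ⟨J, hJ, hJ1⟩ := exists_covariant_quarterTurn hbar_pos hψ1 hψ2 hF1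
    have h1 := (integrable_corr_prod hJ1).integral_norm_prod_left.const_mul (2 * Real.pi * hbar)⁻¹
    have h2 := (h1.comp_add_left (ν / lam μ ν * (X / lam μ ν))).comp_mul_left'
      (div_ne_zero hμ hl)
    refine h2.mono' hm (Filter.Eventually.of_forall fun s => ?_)
    have h3 := wigner_covariant hJ (hψ2.toLp ψ) ![(linePoint X μ ν s).1, (linePoint X μ ν s).2]
    rw [wigner_congr_ae hψ2.coeFn_toLp, rotation_mulVec] at h3
    simp only [Matrix.cons_val_zero, Matrix.cons_val_one, lam_zero_one] at h3
    rw [← h3]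
    refine (norm_wigner_le hbar_pos _ _ _).trans (le_of_eq ?_)
    simp [linePoint]
  · have h1 := (integrable_corr_prod hψ1).integral_norm_prod_left.const_mul
      (2 * Real.pi * hbar)⁻¹
    have h2 := (h1.comp_add_left (μ / lam μ ν * (X / lam μ ν))).comp_mul_left'
      (neg_ne_zero.2 (div_ne_zero hν hl))
    refine h2.mono' hm (Filter.Eventually.of_forall fun s => ?_)
    refine (norm_wigner_le hbar_pos _ _ _).trans (le_of_eq ?_)
    simp only [linePoint, neg_mul, sub_eq_add_neg]

theorem integrable_wigner_lineDelta (hbar_pos : 0 < hbar) (hψ : Continuous ψ)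
    (hψ1 : Integrable ψ) (hψ2 : MemLp ψ 2) (hF1 : Integrable (hbarFourier hbar ψ))
    {μ ν : ℝ} (h : (μ, ν) ≠ (0, 0)) (X : ℝ) :
    Integrable (fun z : ℝ × ℝ => wigner hbar ψ z.1 z.2) (lineDelta X μ ν) := by
  rw [lineDelta_eq]
  refine Integrable.smul_measure ?_ ENNReal.ofReal_ne_top
  rw [integrable_map_measure (stronglyMeasurable_wigner hψ).aestronglyMeasurable
    (continuous_linePoint X μ ν).measurable.aemeasurable]
  exact integrable_wigner_linePoint hbar_pos hψ hψ1 hψ2 hF1 h X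

/-- The position marginal of the Wigner function: one-dimensional Fourier inversion at `y = 0`. -/
theorem integral_wigner_eq_norm_sq (hbar_pos : 0 < hbar) {φ : ℝ → ℂ} (hφ : Continuous φ)
    (hφ2 : MemLp φ 2) (x : ℝ) (hW : Integrable (fun p => wigner hbar φ x p)) :
    ∫ p : ℝ, wigner hbar φ x p = ((‖φ x‖ ^ 2 : ℝ) : ℂ) := by
  have hπ : 0 < 2 * Real.pi * hbar := by positivity
  have hπ' : ((2 * Real.pi * hbar : ℝ) : ℂ) ≠ 0 := by exact_mod_cast hπ.ne'
  have hc : Continuous (fun y => corr φ x y) := by unfold corr; fun_prop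
  simp only [wigner_eq_fourier_corr hbar_pos] at hW ⊢
  have hI : Integrable (𝓕 (fun y => corr φ x y)) := by
    have h1 := (hW.const_mul ((2 * Real.pi * hbar : ℝ) : ℂ)).comp_mul_left' hπ.ne'
    refine h1.congr (Filter.Eventually.of_forall fun t => ?_)
    simp only
    rw [mul_inv_cancel_left₀ hπ', inv_mul_cancel_left₀ hπ.ne']
  have h2 := congrFun (hc.fourierInv_fourier_eq (integrable_corr_right hφ2 x) hI) 0
  rw [Real.fourierInv_eq'] at h2
  simp only [inner_zero_right, mul_zero, Complex.ofReal_zero, zero_mul, Complex.exp_zero,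
    one_smul] at h2
  rw [integral_const_mul, Measure.integral_comp_mul_left (fun t => 𝓕 (fun y => corr φ x y) t),
    h2, inv_inv, abs_of_pos hπ, Complex.real_smul, inv_mul_cancel_left₀ hπ']
  simp only [corr, zero_div, add_zero, sub_zero, Complex.mul_conj, Complex.normSq_eq_norm_sq]

/-- By covariance, the integral of `Wψ` over a line is a position marginal of the Wigner function of
the rotated wave function. -/
theorem radon_eq_norm_sq (hbar_pos : 0 < hbar) (hψ : Continuous ψ)
    (hψ1 : Integrable ψ) (hψ2 : MemLp ψ 2) (hF1 : Integrable (hbarFourier hbar ψ))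
    {μ ν : ℝ} (h : (μ, ν) ≠ (0, 0)) {T : L2R ≃ₗᵢ[ℂ] L2R}
    (hT : (T, rotation μ ν h) ∈ covariantGraph hbar) {φ : ℝ → ℂ} (hφ : Continuous φ)
    (hTφ : ∀ᵐ x : ℝ, T (hψ2.toLp ψ) x = φ x) (X : ℝ) :
    radon hbar ψ X μ ν = (((lam μ ν)⁻¹ * ‖φ ((lam μ ν)⁻¹ * X)‖ ^ 2 : ℝ) : ℂ) := by
  have hφ2 : MemLp φ 2 := (memLp_congr_ae hTφ).1 (Lp.memLp _)
  have h1 : ∀ s, wigner hbar ψ (linePoint X μ ν s).1 (linePoint X μ ν s).2 =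
      wigner hbar φ (X / lam μ ν) s := by
    intro s
    have h3 := wigner_covariant hT (hψ2.toLp ψ) ![(linePoint X μ ν s).1, (linePoint X μ ν s).2]
    rw [wigner_congr_ae hψ2.coeFn_toLp, wigner_congr_ae hTφ, rotation_mulVec_linePoint] at h3
    exact h3.symm
  have h2 := integrable_wigner_linePoint hbar_pos hψ hψ1 hψ2 hF1 h X
  simp only [h1] at h2
  have hl : 0 ≤ (lam μ ν)⁻¹ := inv_nonneg.2 (Real.sqrt_nonneg _)
  unfold radon
  rw [lineDelta_eq, integral_smul_measure, integral_map
    (continuous_linePoint X μ ν).measurable.aemeasurable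
    (stronglyMeasurable_wigner hψ).aestronglyMeasurable]
  simp only [h1]
  rw [integral_wigner_eq_norm_sq hbar_pos hφ hφ2 _ h2, ENNReal.toReal_ofReal hl,
    Complex.real_smul, ← Complex.ofReal_mul, div_eq_inv_mul]

end Lines

/-! ### Partial Fourier inversion of the ambiguity function -/

section AmbiguityPlane

variable {hbar : ℝ} {ψ : ℝ → ℂ}

/-- The ambiguity function is dominated by an integrable function of `μ` alone, because the
quarter turn exchanges the roles of `μ` and `ν`. -/
theorem exists_integrable_bound_ambiguity (hbar_pos : 0 < hbar) (hψ1 : Integrable ψ)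
    (hψ2 : MemLp ψ 2) (hF1 : Integrable (hbarFourier hbar ψ)) :
    ∃ E : ℝ → ℝ, Integrable E ∧ ∀ μ ν, ‖ambiguity hbar ψ μ ν‖ ≤ E μ := by
  obtain ⟨J, hJ, hJ1⟩ := exists_covariant_quarterTurn hbar_pos hψ1 hψ2 hF1
  refine ⟨_, (integrable_corr_prod hJ1).integral_norm_prod_right.comp_neg, fun μ ν => ?_⟩
  have h1 := ambiguity_covariant hJ (hψ2.toLp ψ) ![-ν / 2, μ / 2]
  rw [ambiguity_congr_ae hψ2.coeFn_toLp, rotation_mulVec] at h1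
  simp only [Matrix.cons_val_zero, Matrix.cons_val_one, lam_zero_one] at h1
  rw [show 2 * (μ / 2) = μ by ring, show -2 * (-ν / 2) = ν by ring,
    show 2 * (-1 / 1 * (-ν / 2) + 0 / 1 * (μ / 2)) = ν by ring,
    show -2 * (0 / 1 * (-ν / 2) + 1 / 1 * (μ / 2)) = -μ by ring] at h1
  rw [← h1]
  exact norm_ambiguity_le _ _ _ _

/-- Plancherel's identity for the Fourier integral. -/
theorem integral_norm_sq_fourier {k : ℝ → ℂ} (hk1 : Integrable k) (hk2 : MemLp k 2) :
    ∫ t, ‖𝓕 k t‖ ^ 2 = ∫ x, ‖k x‖ ^ 2 := by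
  have hn : ∀ {u : ℝ → ℂ}, MemLp u 2 → ∫ t, ‖u t‖ ^ 2 = (eLpNorm u 2).toReal ^ 2 := by
    intro u hu
    have h1 : ‖hu.toLp u‖ ^ 2 = ∫ t, ‖u t‖ ^ 2 := by
      rw [← @inner_self_eq_norm_sq ℂ, L2.inner_def]
      rw [integral_congr_ae (g := fun t => ((‖u t‖ ^ 2 : ℝ) : ℂ))]
      · rw [integral_complex_ofReal]; simp
      · filter_upwards [hu.coeFn_toLp] with t ht
        rw [ht, inner_self_eq_norm_sq_to_K]
        push_cast
        rfl
    rw [← h1, Lp.norm_toLp]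
  rw [hn (memLp_fourier hk1 hk2), hn hk2, eLpNorm_fourier hk1 hk2]

/-- The ambiguity function is square integrable: Plancherel in `x` for almost every `ν`, then
integration over `ν`. -/
theorem memLp_ambiguity_prod (hbar_pos : 0 < hbar) (hψ : Continuous ψ) (hψ2 : MemLp ψ 2) :
    MemLp (fun z : ℝ × ℝ => ambiguity hbar ψ z.1 z.2) 2 (volume.prod volume) := by
  have hπ : 0 < 2 * Real.pi * hbar := by positivity
  have hπ' : -(2 * Real.pi * hbar)⁻¹ ≠ 0 := neg_ne_zero.2 (inv_ne_zero hπ.ne')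
  have hm := (stronglyMeasurable_ambiguity (hbar := hbar) hψ).aestronglyMeasurable
    (μ := (volume : Measure ℝ).prod (volume : Measure ℝ))
  have hm' : AEStronglyMeasurable (fun z : ℝ × ℝ => ‖ambiguity hbar ψ z.1 z.2‖ ^ 2)
      (volume.prod volume) := hm.norm.pow 2
  rw [memLp_two_iff_integrable_sq_norm hm, integrable_prod_iff' hm']
  have hc := (memLp_two_iff_integrable_sq_norm (memLp_corr_prod hψ2).1).1 (memLp_corr_prod hψ2)
  constructor
  · filter_upwards [ae_memLp_corr_left hψ2] with ν hν
    simp only [ambiguity_eq_fourier_corr hbar_pos]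
    have h1 := memLp_fourier (integrable_corr_left hψ2 ν) hν
    exact ((memLp_two_iff_integrable_sq_norm h1.1).1 h1).comp_mul_left' hπ'
  · refine (hc.integral_prod_right.const_mul (2 * Real.pi * hbar)).congr ?_
    filter_upwards [ae_memLp_corr_left hψ2] with ν hν
    simp only [ambiguity_eq_fourier_corr hbar_pos, norm_pow, norm_norm]
    rw [Measure.integral_comp_mul_left (fun t => ‖𝓕 (fun x => corr ψ x ν) t‖ ^ 2),
      integral_norm_sq_fourier (integrable_corr_left hψ2 ν) hν, abs_inv, abs_neg, abs_inv, inv_inv,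
      abs_of_pos hπ, smul_eq_mul]

/-- Fourier inversion in the variable `μ`. -/
theorem integral_ambiguity_mul_exp (hbar_pos : 0 < hbar) (hψ : Continuous ψ) (hψ2 : MemLp ψ 2)
    (ν : ℝ) (hA : Integrable (fun μ => ambiguity hbar ψ μ ν)) (x : ℝ) :
    ∫ μ : ℝ, ambiguity hbar ψ μ ν * Complex.exp (-(Complex.I * ((μ * x / hbar : ℝ) : ℂ))) =
      ((2 * Real.pi * hbar : ℝ) : ℂ) * corr ψ x ν := by
  have hπ : 0 < 2 * Real.pi * hbar := by positivity
  have hπ' : -(2 * Real.pi * hbar)⁻¹ ≠ 0 := neg_ne_zero.2 (inv_ne_zero hπ.ne')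
  have hh : (hbar : ℂ) ≠ 0 := by exact_mod_cast hbar_pos.ne'
  have hpi : (Real.pi : ℂ) ≠ 0 := by exact_mod_cast Real.pi_ne_zero
  have hc : Continuous (fun x => corr ψ x ν) := by unfold corr; fun_prop
  simp only [ambiguity_eq_fourier_corr hbar_pos] at hA ⊢
  have hI : Integrable (𝓕 (fun x => corr ψ x ν)) := by
    refine (hA.comp_mul_left' (inv_ne_zero hπ')).congr (Filter.Eventually.of_forall fun t => ?_)
    simp only [mul_inv_cancel_left₀ hπ']
  have h2 := congrFun (hc.fourierInv_fourier_eq (integrable_corr_left hψ2 ν) hI) x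
  rw [Real.fourierInv_eq'] at h2
  rw [← h2]
  have h3 := Measure.integral_comp_mul_left (fun t => Complex.exp ((2 * Real.pi * (t * x) : ℝ) *
    Complex.I) * 𝓕 (fun x => corr ψ x ν) t) (-(2 * Real.pi * hbar)⁻¹)
  rw [abs_inv, abs_neg, abs_inv, inv_inv, abs_of_pos hπ, Complex.real_smul] at h3
  refine Eq.trans ?_ (h3.trans ?_)
  · refine integral_congr_ae (Filter.Eventually.of_forall fun μ => ?_)
    simp only
    rw [mul_comm]
    congr 2
    push_cast
    field_simp
  · congr 1
    refine integral_congr_ae (Filter.Eventually.of_forall fun t => ?_)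
    simp [mul_comm]

/-- A partial inversion formula: the Fourier integral of the ambiguity function weighted by
`χ(ν)` is the Fourier integral in `y` of the weighted correlation kernel. -/
theorem integral_weighted_ambiguity (hbar_pos : 0 < hbar) (hψ : Continuous ψ) (hψ1 : Integrable ψ)
    (hψ2 : MemLp ψ 2) (hF1 : Integrable (hbarFourier hbar ψ)) (χ : ℝ → ℂ)
    (hχ : Integrable (fun z : ℝ × ℝ => χ z.2 * ambiguity hbar ψ z.1 z.2) (volume.prod volume))
    (x p : ℝ) :
    ∫ z : ℝ × ℝ, χ z.2 * ambiguity hbar ψ z.1 z.2 *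
        Complex.exp (-(Complex.I * (((z.1 * x + z.2 * p) / hbar : ℝ) : ℂ))) =
      ((2 * Real.pi * hbar : ℝ) : ℂ) * ∫ y : ℝ, χ y *
        (Complex.exp (-(Complex.I * ((p * y / hbar : ℝ) : ℂ))) * corr ψ x y) := by
  obtain ⟨E, hE, hAE⟩ := exists_integrable_bound_ambiguity hbar_pos hψ1 hψ2 hF1
  have hA : ∀ ν, Integrable (fun μ => ambiguity hbar ψ μ ν) := by
    intro ν
    refine hE.mono' ?_ (Filter.Eventually.of_forall fun μ => hAE μ ν)
    exact ((stronglyMeasurable_ambiguity hψ).comp_measurable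
      (g := fun μ : ℝ => (μ, ν)) (by fun_prop)).aestronglyMeasurable
  have hint : Integrable (fun z : ℝ × ℝ => χ z.2 * ambiguity hbar ψ z.1 z.2 *
        Complex.exp (-(Complex.I * (((z.1 * x + z.2 * p) / hbar : ℝ) : ℂ))))
        (volume.prod volume) := by
    refine hχ.mul_bdd (c := 1) (Continuous.aestronglyMeasurable (by fun_prop)) ?_
    exact Filter.Eventually.of_forall fun z => (norm_exp_neg_I_mul_ofReal _).le
  rw [Measure.volume_eq_prod, integral_prod_symm _ hint, ← integral_const_mul]
  refine integral_congr_ae (Filter.Eventually.of_forall fun y => ?_)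
  simp only
  rw [mul_left_comm, mul_left_comm _ (Complex.exp _),
    ← integral_ambiguity_mul_exp hbar_pos hψ hψ2 y (hA y) x, ← integral_const_mul,
    ← integral_const_mul]
  refine integral_congr_ae (Filter.Eventually.of_forall fun μ => ?_)
  simp only
  rw [show Complex.exp (-(Complex.I * (((μ * x + y * p) / hbar : ℝ) : ℂ))) =
      Complex.exp (-(Complex.I * ((p * y / hbar : ℝ) : ℂ))) *
        Complex.exp (-(Complex.I * ((μ * x / hbar : ℝ) : ℂ))) by
    rw [← Complex.exp_add]; congr 1; push_cast; ring]
  ring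

end AmbiguityPlane

/-! ### The Fourier transform of the ambiguity function on the plane -/

section PlaneFourier

variable {hbar : ℝ} {ψ : ℝ → ℂ}

/-- The identification of the Euclidean plane with `ℝ × ℝ`. -/
def planeEquiv : Plane ≃ᵐ ℝ × ℝ :=
  (MeasurableEquiv.toLp 2 (Fin 2 → ℝ)).symm.trans MeasurableEquiv.finTwoArrow

theorem planeEquiv_apply (w : Plane) : planeEquiv w = (w 0, w 1) := rfl

theorem measurePreserving_planeEquiv :
    MeasurePreserving planeEquiv volume (volume.prod volume) :=
  (volume_preserving_finTwoArrow ℝ).comp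
    (EuclideanSpace.volume_preserving_symm_measurableEquiv_toLp (Fin 2))

theorem measurePreserving_coordinates :
    MeasurePreserving (fun w : Plane => (w 0, w 1)) volume (volume.prod volume) :=
  measurePreserving_planeEquiv

theorem memLp_comp_coordinates {F : ℝ × ℝ → ℂ} (h : MemLp F 2 (volume.prod volume)) :
    MemLp (fun w : Plane => F (w 0, w 1)) 2 volume :=
  h.comp_measurePreserving measurePreserving_coordinates

theorem memLp_ambiguity_plane (hbar_pos : 0 < hbar) (hψ : Continuous ψ) (hψ2 : MemLp ψ 2) :
    MemLp (fun w : Plane => ambiguity hbar ψ (w 0) (w 1)) 2 volume :=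
  memLp_comp_coordinates (memLp_ambiguity_prod hbar_pos hψ hψ2)

/-- The indicator of `[-n, n]` as a weight in the variable `ν`. -/
def cutoff (n : ℕ) (y : ℝ) : ℂ := (Metric.closedBall (0 : ℝ) n).indicator 1 y

theorem norm_cutoff_le (n : ℕ) (y : ℝ) : ‖cutoff n y‖ ≤ 1 := by
  unfold cutoff
  by_cases h : y ∈ Metric.closedBall (0 : ℝ) n <;> simp [h]

theorem measurable_cutoff (n : ℕ) : Measurable (cutoff n) :=
  measurable_one.indicator measurableSet_closedBall

theorem tendsto_cutoff (y : ℝ) :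
    Filter.Tendsto (fun n => cutoff n y) Filter.atTop (nhds 1) := by
  obtain ⟨N, hN⟩ := exists_nat_ge |y|
  refine tendsto_const_nhds.congr' ?_
  filter_upwards [Filter.eventually_ge_atTop N] with n hn
  have : y ∈ Metric.closedBall (0 : ℝ) n := by
    rw [mem_closedBall_zero_iff, Real.norm_eq_abs]
    exact hN.trans (by exact_mod_cast hn)
  simp [cutoff, this]

theorem integrable_cutoff (n : ℕ) : Integrable (cutoff n) :=
  (integrable_indicator_iff measurableSet_closedBall).2
    (integrableOn_const (isCompact_closedBall _ _).measure_ne_top)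

theorem integrable_cutoff_mul_ambiguity (hbar_pos : 0 < hbar) (hψ : Continuous ψ)
    (hψ1 : Integrable ψ) (hψ2 : MemLp ψ 2) (hF1 : Integrable (hbarFourier hbar ψ)) (n : ℕ) :
    Integrable (fun z : ℝ × ℝ => cutoff n z.2 * ambiguity hbar ψ z.1 z.2)
      (volume.prod volume) := by
  obtain ⟨E, hE, hAE⟩ := exists_integrable_bound_ambiguity hbar_pos hψ1 hψ2 hF1
  refine (hE.mul_prod (integrable_cutoff n).norm).mono' ?_ (Filter.Eventually.of_forall fun z => ?_)
  · exact ((measurable_cutoff n).comp measurable_snd).aestronglyMeasurable.mul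
      (stronglyMeasurable_ambiguity hψ).aestronglyMeasurable
  · rw [norm_mul, mul_comm]
    exact mul_le_mul_of_nonneg_right (hAE _ _) (norm_nonneg _)

theorem memLp_cutoff_mul_ambiguity (hbar_pos : 0 < hbar) (hψ : Continuous ψ)
    (hψ2 : MemLp ψ 2) (n : ℕ) :
    MemLp (fun w : Plane => cutoff n (w 1) * ambiguity hbar ψ (w 0) (w 1)) 2 volume := by
  have h1 := memLp_ambiguity_prod hbar_pos hψ hψ2
  have h2 : MemLp (fun z : ℝ × ℝ => cutoff n z.2 * ambiguity hbar ψ z.1 z.2) 2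
      (volume.prod volume) := by
    refine h1.mono ?_ (Filter.Eventually.of_forall fun z => ?_)
    · exact ((measurable_cutoff n).comp measurable_snd).aestronglyMeasurable.mul h1.1
    · rw [norm_mul]
      exact mul_le_of_le_one_left (norm_nonneg _) (norm_cutoff_le _ _)
  exact memLp_comp_coordinates h2

/-- The Fourier integral on the plane, at the rescaled frequency, written in coordinates. -/
theorem fourier_plane_eq (hbar_pos : 0 < hbar) (F : ℝ × ℝ → ℂ) (z : Plane) :
    𝓕 (fun w : Plane => F (w 0, w 1)) ((2 * Real.pi * hbar)⁻¹ • z) =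
      ∫ y : ℝ × ℝ, F y *
        Complex.exp (-(Complex.I * (((y.1 * z 0 + y.2 * z 1) / hbar : ℝ) : ℂ))) := by
  have h1 := measurePreserving_planeEquiv.integral_comp' (fun y : ℝ × ℝ => F y *
        Complex.exp (-(Complex.I * (((y.1 * z 0 + y.2 * z 1) / hbar : ℝ) : ℂ))))
  rw [Measure.volume_eq_prod, ← h1, Real.fourier_eq']
  refine integral_congr_ae (Filter.Eventually.of_forall fun w => ?_)
  simp only [planeEquiv_apply, smul_eq_mul]
  rw [mul_comm]
  congr 2
  rw [real_inner_smul_right, PiLp.inner_apply, Fin.sum_univ_two]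
  have hh : (hbar : ℂ) ≠ 0 := by exact_mod_cast hbar_pos.ne'
  have hpi : (Real.pi : ℂ) ≠ 0 := by exact_mod_cast Real.pi_ne_zero
  simp only [RCLike.inner_apply, conj_trivial]
  push_cast
  field_simp

/-- The Fourier integrals of the truncated ambiguity function converge to the Wigner function at every
point, since the correlation kernel is integrable in `y` for each `x`. -/
theorem tendsto_fourier_cutoff (hbar_pos : 0 < hbar) (hψ : Continuous ψ)
    (hψ1 : Integrable ψ) (hψ2 : MemLp ψ 2) (hF1 : Integrable (hbarFourier hbar ψ)) (z : Plane) :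
    Filter.Tendsto (fun n => 𝓕 (fun w : Plane => cutoff n (w 1) * ambiguity hbar ψ (w 0) (w 1))
      ((2 * Real.pi * hbar)⁻¹ • z)) Filter.atTop
      (nhds ((((2 * Real.pi * hbar) ^ 2 : ℝ) : ℂ) * wigner hbar ψ (z 0) (z 1))) := by
  have hπ : ((2 * Real.pi * hbar : ℝ) : ℂ) ≠ 0 := by
    exact_mod_cast (by positivity : 0 < 2 * Real.pi * hbar).ne'
  have h1 : ∀ n, 𝓕 (fun w : Plane => cutoff n (w 1) * ambiguity hbar ψ (w 0) (w 1))
      ((2 * Real.pi * hbar)⁻¹ • z) = ((2 * Real.pi * hbar : ℝ) : ℂ) * ∫ y : ℝ, cutoff n y *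
        (Complex.exp (-(Complex.I * ((z 1 * y / hbar : ℝ) : ℂ))) * corr ψ (z 0) y) := by
    intro n
    rw [fourier_plane_eq hbar_pos (fun y => cutoff n y.2 * ambiguity hbar ψ y.1 y.2)]
    exact integral_weighted_ambiguity hbar_pos hψ hψ1 hψ2 hF1 (cutoff n)
      (integrable_cutoff_mul_ambiguity hbar_pos hψ hψ1 hψ2 hF1 n) (z 0) (z 1)
  simp only [h1]
  have h2 : (((2 * Real.pi * hbar) ^ 2 : ℝ) : ℂ) * wigner hbar ψ (z 0) (z 1) =
      ((2 * Real.pi * hbar : ℝ) : ℂ) * ∫ y : ℝ,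
        Complex.exp (-(Complex.I * ((z 1 * y / hbar : ℝ) : ℂ))) * corr ψ (z 0) y := by
    unfold wigner corr
    rw [Complex.ofReal_pow, pow_two, mul_assoc, mul_inv_cancel_left₀ hπ]
  rw [h2]
  refine Filter.Tendsto.const_mul _ (tendsto_integral_of_dominated_convergence
    (fun y => ‖corr ψ (z 0) y‖) ?_ (integrable_corr_right hψ2 _).norm ?_ ?_)
  · intro n
    exact (measurable_cutoff n).aestronglyMeasurable.mul
      ((Continuous.aestronglyMeasurable (by fun_prop)).mul (integrable_corr_right hψ2 _).1)
  · refine fun n => Filter.Eventually.of_forall fun y => ?_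
    rw [norm_mul, norm_mul, norm_exp_neg_I_mul_ofReal, one_mul]
    exact mul_le_of_le_one_left (norm_nonneg _) (norm_cutoff_le _ _)
  · refine Filter.Eventually.of_forall fun y => ?_
    simpa using (tendsto_cutoff y).mul_const
      (Complex.exp (-(Complex.I * ((z 1 * y / hbar : ℝ) : ℂ))) * corr ψ (z 0) y)

/-- Dominated convergence in `L²`. -/
theorem tendsto_eLpNorm_sub_of_dominated {α : Type*} [MeasurableSpace α] {m : Measure α}
    {f : α → ℂ} {F : ℕ → α → ℂ} (hf : MemLp f 2 m) (hF : ∀ n, AEStronglyMeasurable (F n) m)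
    (hb : ∀ n x, ‖F n x - f x‖ ≤ ‖f x‖)
    (hl : ∀ x, Filter.Tendsto (fun n => F n x) Filter.atTop (nhds (f x))) :
    Filter.Tendsto (fun n => eLpNorm (F n - f) 2 m) Filter.atTop (nhds 0) := by
  simp only [eLpNorm_eq_lintegral_rpow_enorm_toReal two_ne_zero ENNReal.ofNat_ne_top,
    ENNReal.toReal_ofNat]
  have h1 : Filter.Tendsto (fun n => ∫⁻ x, ‖(F n - f) x‖ₑ ^ (2 : ℝ) ∂m) Filter.atTop
      (nhds (∫⁻ _, 0 ∂m)) := by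
    refine tendsto_lintegral_of_dominated_convergence' (fun x => ‖f x‖ₑ ^ (2 : ℝ)) ?_ ?_ ?_ ?_
    · exact fun n => (((hF n).sub hf.1).enorm).pow_const _
    · refine fun n => Filter.Eventually.of_forall fun x => ?_
      exact ENNReal.rpow_le_rpow (enorm_le_iff_norm_le.2 (hb n x)) (by norm_num)
    · have := lintegral_rpow_enorm_lt_top_of_eLpNorm_lt_top two_ne_zero ENNReal.ofNat_ne_top hf.2
      simpa using this.ne
    · refine Filter.Eventually.of_forall fun x => ?_
      have h2 : Filter.Tendsto (fun n => ‖(F n - f) x‖ₑ) Filter.atTop (nhds 0) := by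
        have h3 := ((hl x).sub_const (f x)).enorm
        simpa using h3
      have h4 := h2.ennrpow_const 2
      simpa using h4
  rw [lintegral_zero] at h1
  have h5 := h1.ennrpow_const (1 / 2)
  simpa using h5

theorem tendsto_toLp_cutoff (hbar_pos : 0 < hbar) (hψ : Continuous ψ) (hψ2 : MemLp ψ 2) :
    Filter.Tendsto (fun n => (memLp_cutoff_mul_ambiguity hbar_pos hψ hψ2 n).toLp _) Filter.atTop
      (nhds ((memLp_ambiguity_plane hbar_pos hψ hψ2).toLp _)) := by
  rw [Lp.tendsto_Lp_iff_tendsto_eLpNorm'']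
  refine tendsto_eLpNorm_sub_of_dominated (memLp_ambiguity_plane hbar_pos hψ hψ2)
    (fun n => (memLp_cutoff_mul_ambiguity hbar_pos hψ hψ2 n).1) (fun n w => ?_) (fun w => ?_)
  · unfold cutoff
    by_cases h : w 1 ∈ Metric.closedBall (0 : ℝ) n <;> simp [h]
  · simpa using (tendsto_cutoff (w 1)).mul_const (ambiguity hbar ψ (w 0) (w 1))

/-- The Plancherel transform of the ambiguity function is the Wigner function: truncate in `ν`,
where the transform is an integral, and let the truncation tend to infinity. -/
theorem planeFourierL2_ambiguity (hbar_pos : 0 < hbar) (hψ : Continuous ψ)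
    (hψ1 : Integrable ψ) (hψ2 : MemLp ψ 2) (hF1 : Integrable (hbarFourier hbar ψ)) :
    ∀ᵐ z : Plane, planeFourierL2 hbar ((memLp_ambiguity_plane hbar_pos hψ hψ2).toLp _) z =
      (((2 * Real.pi * hbar) ^ 2 : ℝ) : ℂ) * wigner hbar ψ (z 0) (z 1) := by
  have h1 := ((Lp.fourierTransformₗᵢ Plane ℂ).continuous.tendsto _).comp
    (tendsto_toLp_cutoff hbar_pos hψ hψ2)
  obtain ⟨ns, hns, hae⟩ := (tendstoInMeasure_of_tendsto_Lp h1).exists_seq_tendsto_ae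
  have h2 : ∀ᵐ w : Plane, ∀ n, Lp.fourierTransformₗᵢ Plane ℂ
      ((memLp_cutoff_mul_ambiguity hbar_pos hψ hψ2 n).toLp _) w =
      𝓕 (fun w : Plane => cutoff n (w 1) * ambiguity hbar ψ (w 0) (w 1)) w := by
    rw [ae_all_iff]
    intro n
    exact fourier_toLp_ae_eq
      (measurePreserving_coordinates.integrable_comp_of_integrable
        (integrable_cutoff_mul_ambiguity hbar_pos hψ hψ1 hψ2 hF1 n)) (memLp_cutoff_mul_ambiguity hbar_pos hψ hψ2 n)
  have hπ : (2 * Real.pi * hbar)⁻¹ ≠ 0 := (by positivity : 0 < (2 * Real.pi * hbar)⁻¹).ne'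
  have hq : Measure.QuasiMeasurePreserving (fun z : Plane => (2 * Real.pi * hbar)⁻¹ • z)
      volume volume := by
    refine ⟨measurable_const_smul _, ?_⟩
    rw [Measure.map_addHaar_smul volume hπ]
    exact Measure.smul_absolutelyContinuous
  filter_upwards [hq.ae hae, hq.ae h2] with z h3 h4
  refine tendsto_nhds_unique h3 ?_
  simp only [Function.comp_apply, h4]
  exact (tendsto_fourier_cutoff hbar_pos hψ hψ1 hψ2 hF1 z).comp hns.tendsto_atTop

end PlaneFourier

/-! ### The inversion formula -/

section Inversion

variable {hbar : ℝ} {ψ : ℝ → ℂ}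

theorem integrable_radon (hbar_pos : 0 < hbar) (hψ : Continuous ψ)
    (hψ1 : Integrable ψ) (hψ2 : MemLp ψ 2) (hF1 : Integrable (hbarFourier hbar ψ))
    {μ ν : ℝ} (h : (μ, ν) ≠ (0, 0)) : Integrable (fun X => radon hbar ψ X μ ν) := by
  obtain ⟨T, hT, φ, hφ, hTφ⟩ := exists_covariant_continuous_ae hbar_pos hψ hψ1 hψ2 h
  simp only [radon_eq_norm_sq hbar_pos hψ hψ1 hψ2 hF1 h hT hφ hTφ]
  have hφ2 : MemLp φ 2 := (memLp_congr_ae hTφ).1 (Lp.memLp _)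
  exact ((((memLp_two_iff_integrable_sq_norm hφ2.1).1 hφ2).comp_mul_left'
    (inv_ne_zero (lam_ne_zero h))).const_mul _).ofReal

/-- The Fourier transform of the Radon transform along a ray is the ambiguity function on that
ray, since both sides are covariant and agree for `μ = λ`, `ν = 0`. -/
theorem radonFourier_eq_ambiguity (hbar_pos : 0 < hbar) (hψ : Continuous ψ)
    (hψ1 : Integrable ψ) (hψ2 : MemLp ψ 2) (hF1 : Integrable (hbarFourier hbar ψ))
    (w : Plane) (h : (w 0, w 1) ≠ (0, 0)) :
    radonFourier hbar ψ w = ambiguity hbar ψ (w 0) (w 1) := by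
  obtain ⟨T, hT, φ, hφ, hTφ⟩ := exists_covariant_continuous_ae hbar_pos hψ hψ1 hψ2 h
  unfold radonFourier
  simp only [radon_eq_norm_sq hbar_pos hψ hψ1 hψ2 hF1 h hT hφ hTφ]
  set μ := w 0
  set ν := w 1
  have hl := lam_ne_zero h
  have hl0 : 0 < lam μ ν := lt_of_le_of_ne (Real.sqrt_nonneg _) hl.symm
  -- The rotation maps `(-ν/2, μ/2)` to `(0, λ/2)`.
  have h1 := ambiguity_covariant hT (hψ2.toLp ψ) ![-ν / 2, μ / 2]
  rw [ambiguity_congr_ae hψ2.coeFn_toLp, ambiguity_congr_ae hTφ, rotation_mulVec] at h1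
  simp only [Matrix.cons_val_zero, Matrix.cons_val_one] at h1
  have h2 : 2 * (-ν / lam μ ν * (-ν / 2) + μ / lam μ ν * (μ / 2)) = lam μ ν := by
    field_simp
    linarith [lam_sq μ ν]
  have h3 : -2 * (μ / lam μ ν * (-ν / 2) + ν / lam μ ν * (μ / 2)) = 0 := by ring
  rw [h2, h3, show 2 * (μ / 2) = μ by ring, show -2 * (-ν / 2) = ν by ring] at h1
  rw [← h1]
  have h4 := Measure.integral_comp_mul_left
    (fun x : ℝ => Complex.exp (Complex.I * ((lam μ ν * x / hbar : ℝ) : ℂ)) * corr φ x 0)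
    (lam μ ν)⁻¹
  rw [inv_inv, abs_of_pos hl0, Complex.real_smul] at h4
  have h5 : ambiguity hbar φ (lam μ ν) 0 = ((lam μ ν : ℝ) : ℂ)⁻¹ *
      ∫ X : ℝ, Complex.exp (Complex.I * ((lam μ ν * ((lam μ ν)⁻¹ * X) / hbar : ℝ) : ℂ)) *
        corr φ ((lam μ ν)⁻¹ * X) 0 := by
    rw [h4, inv_mul_cancel_left₀ (by exact_mod_cast hl)]
    rfl
  rw [h5, ← integral_const_mul]
  refine integral_congr_ae (Filter.Eventually.of_forall fun X => ?_)
  simp only [corr, zero_div, add_zero, sub_zero, Complex.mul_conj, Complex.normSq_eq_norm_sq]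
  rw [mul_inv_cancel_left₀ hl]
  push_cast
  ring

theorem ae_radonFourier_eq_ambiguity (hbar_pos : 0 < hbar) (hψ : Continuous ψ)
    (hψ1 : Integrable ψ) (hψ2 : MemLp ψ 2) (hF1 : Integrable (hbarFourier hbar ψ)) :
    radonFourier hbar ψ =ᵐ[volume] fun w : Plane => ambiguity hbar ψ (w 0) (w 1) := by
  have h0 : ∀ᵐ w : Plane, w ≠ 0 := by
    rw [ae_iff]; simp
  filter_upwards [h0] with w hw
  refine radonFourier_eq_ambiguity hbar_pos hψ hψ1 hψ2 hF1 w fun h => hw ?_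
  rw [Prod.mk.injEq] at h
  ext i
  fin_cases i
  · exact h.1
  · exact h.2

/-- If `G` is integrable, Fubini's theorem applies without truncation. -/
theorem wigner_eq_integral_of_integrable (hbar_pos : 0 < hbar) (hψ : Continuous ψ)
    (hψ1 : Integrable ψ) (hψ2 : MemLp ψ 2) (hF1 : Integrable (hbarFourier hbar ψ))
    (hG : Integrable (radonFourier hbar ψ)) (x p : ℝ) :
    wigner hbar ψ x p = (((2 * Real.pi * hbar) ^ 2 : ℝ) : ℂ)⁻¹ *
      ∫ w : Plane, radonFourier hbar ψ w *
        Complex.exp (-(Complex.I * (((w 0 * x + w 1 * p) / hbar : ℝ) : ℂ))) := by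
  have hπ : ((2 * Real.pi * hbar : ℝ) : ℂ) ≠ 0 := by
    exact_mod_cast (by positivity : 0 < 2 * Real.pi * hbar).ne'
  have hae := ae_radonFourier_eq_ambiguity hbar_pos hψ hψ1 hψ2 hF1
  have hA : Integrable (fun z : ℝ × ℝ => 1 * ambiguity hbar ψ z.1 z.2) (volume.prod volume) := by
    simp only [one_mul]
    exact (measurePreserving_planeEquiv.integrable_comp_emb
      planeEquiv.measurableEmbedding).1 (hG.congr hae)
  have h1 := integral_weighted_ambiguity hbar_pos hψ hψ1 hψ2 hF1 (fun _ => 1) hA x p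
  simp only [one_mul] at h1
  have h2 : ∫ w : Plane, radonFourier hbar ψ w *
        Complex.exp (-(Complex.I * (((w 0 * x + w 1 * p) / hbar : ℝ) : ℂ))) =
      ∫ z : ℝ × ℝ, ambiguity hbar ψ z.1 z.2 *
        Complex.exp (-(Complex.I * (((z.1 * x + z.2 * p) / hbar : ℝ) : ℂ))) := by
    rw [Measure.volume_eq_prod, ← measurePreserving_planeEquiv.integral_comp']
    refine integral_congr_ae ?_
    filter_upwards [hae] with w hw
    rw [hw]
    rfl
  rw [h2, h1, Complex.ofReal_pow, pow_two, mul_inv, mul_assoc, inv_mul_cancel_left₀ hπ]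
  rfl

end Inversion

/-! ### Replacing the wave function by its continuous version -/

section ContinuousVersion

variable {hbar : ℝ} {ψ : ℝ → ℂ}

theorem integrable_fourier_of_hbarFourier (hbar_pos : 0 < hbar)
    (hF1 : Integrable (hbarFourier hbar ψ)) : Integrable (𝓕 ψ) := by
  have hπ : 0 < 2 * Real.pi * hbar := by positivity
  have hs : ((Real.sqrt (2 * Real.pi * hbar) : ℝ) : ℂ) ≠ 0 := by
    exact_mod_cast (Real.sqrt_pos.2 hπ).ne'
  refine ((hF1.const_mul ((Real.sqrt (2 * Real.pi * hbar) : ℝ) : ℂ)).comp_mul_left'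
    hπ.ne').congr (Filter.Eventually.of_forall fun t => ?_)
  simp only [hbarFourier]
  rw [mul_inv_cancel_left₀ hs, Real.fourier_real_eq_integral_exp_smul]
  refine integral_congr_ae (Filter.Eventually.of_forall fun x => ?_)
  simp only [smul_eq_mul]
  congr 2
  have hh : (hbar : ℂ) ≠ 0 := by exact_mod_cast hbar_pos.ne'
  push_cast
  field_simp

theorem hbarFourier_congr_ae {φ : ℝ → ℂ} (h : ψ =ᵐ[volume] φ) :
    hbarFourier hbar ψ = hbarFourier hbar φ := by
  ext p
  unfold hbarFourier
  congr 1
  refine integral_congr_ae ?_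
  filter_upwards [h] with x hx
  rw [hx]

/-- A function in `L¹ ∩ L²` with integrable Fourier transform has a continuous version. -/
theorem exists_continuous_version (hbar_pos : 0 < hbar) (hψ1 : Integrable ψ) (hψ2 : MemLp ψ 2)
    (hF1 : Integrable (hbarFourier hbar ψ)) :
    ∃ φ : ℝ → ℂ, Continuous φ ∧ ψ =ᵐ[volume] φ := by
  have hF := integrable_fourier_of_hbarFourier hbar_pos hF1
  exact ⟨𝓕⁻ (𝓕 ψ), continuous_fourierInv_of_integrable hF,
    (fourierInv_fourier_ae_eq hψ1 hψ2 hF).symm⟩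

theorem radon_congr_ae {φ : ℝ → ℂ} (h : ψ =ᵐ[volume] φ) : radon hbar ψ = radon hbar φ := by
  unfold radon
  rw [wigner_congr_ae h]

theorem radonFourier_congr_ae {φ : ℝ → ℂ} (h : ψ =ᵐ[volume] φ) :
    radonFourier hbar ψ = radonFourier hbar φ := by
  unfold radonFourier
  rw [radon_congr_ae h]

end ContinuousVersion

end RadonWigner

end

theorem mainTheorem1 (hbar : ℝ) (hbar_pos : 0 < hbar) (ψ : ℝ → ℂ)
    (hψ1 : Integrable ψ) (hψ2 : MemLp ψ 2)
    (hF1 : Integrable (RadonWigner.hbarFourier hbar ψ))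
    (hF2 : MemLp (RadonWigner.hbarFourier hbar ψ) 2) :
    -- (i)
    (∀ (μ ν : ℝ) (h : (μ, ν) ≠ (0, 0)),
      (∀ X : ℝ, Integrable (fun z : ℝ × ℝ => RadonWigner.wigner hbar ψ z.1 z.2)
        (RadonWigner.lineDelta X μ ν)) ∧
      (∃ T : RadonWigner.L2R ≃ₗᵢ[ℂ] RadonWigner.L2R,
        RadonWigner.Covers hbar T (RadonWigner.rotation μ ν h)) ∧
      ∀ T : RadonWigner.L2R ≃ₗᵢ[ℂ] RadonWigner.L2R,
        RadonWigner.Covers hbar T (RadonWigner.rotation μ ν h) →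
        ∃ φ : ℝ → ℂ, Continuous φ ∧ (∀ᵐ x : ℝ, T (hψ2.toLp ψ) x = φ x) ∧
          ∀ X : ℝ, RadonWigner.radon hbar ψ X μ ν =
            (((RadonWigner.lam μ ν)⁻¹ * ‖φ ((RadonWigner.lam μ ν)⁻¹ * X)‖ ^ 2 : ℝ) : ℂ)) ∧
    -- (ii)
    ((∀ μ ν : ℝ, (μ, ν) ≠ (0, 0) → Integrable (fun X : ℝ => RadonWigner.radon hbar ψ X μ ν)) ∧
      (∃ hG : MemLp (RadonWigner.radonFourier hbar ψ) 2 volume,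
        ∀ᵐ z : RadonWigner.Plane, RadonWigner.wigner hbar ψ (z 0) (z 1) =
          (((2 * Real.pi * hbar) ^ 2 : ℝ) : ℂ)⁻¹ *
            RadonWigner.planeFourierL2 hbar (hG.toLp (RadonWigner.radonFourier hbar ψ)) z) ∧
      (Integrable (RadonWigner.radonFourier hbar ψ) →
        ∀ x p : ℝ, RadonWigner.wigner hbar ψ x p =
          (((2 * Real.pi * hbar) ^ 2 : ℝ) : ℂ)⁻¹ *
            ∫ w : RadonWigner.Plane, RadonWigner.radonFourier hbar ψ w *
              Complex.exp (-(Complex.I * (((w 0 * x + w 1 * p) / hbar : ℝ) : ℂ))))) := by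
  obtain ⟨φ, hφ, hae⟩ := RadonWigner.exists_continuous_version hbar_pos hψ1 hψ2 hF1
  have hφ1 : Integrable φ := hψ1.congr hae
  have hφ2 : MemLp φ 2 := (memLp_congr_ae hae).1 hψ2
  have hLp : hψ2.toLp ψ = hφ2.toLp φ := MemLp.toLp_congr hψ2 hφ2 hae
  rw [RadonWigner.hbarFourier_congr_ae hae] at hF1
  have hπ : (((2 * Real.pi * hbar) ^ 2 : ℝ) : ℂ) ≠ 0 := by
    exact_mod_cast (by positivity : 0 < (2 * Real.pi * hbar) ^ 2).ne'
  rw [RadonWigner.wigner_congr_ae hae, RadonWigner.radon_congr_ae hae,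
    RadonWigner.radonFourier_congr_ae hae, hLp]
  refine ⟨fun μ ν h => ⟨fun X =>
    RadonWigner.integrable_wigner_lineDelta hbar_pos hφ hφ1 hφ2 hF1 h X,
    RadonWigner.exists_covers_rotation hbar_pos h, fun T hT => ?_⟩,
    fun μ ν h => RadonWigner.integrable_radon hbar_pos hφ hφ1 hφ2 hF1 h, ?_,
    fun hG x p => RadonWigner.wigner_eq_integral_of_integrable hbar_pos hφ hφ1 hφ2 hF1 hG x p⟩
  · obtain ⟨χ, hχ, hTχ⟩ :=
      RadonWigner.exists_continuous_ae hbar_pos hφ hφ1 hφ2 h hT.mem_covariantGraph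
    exact ⟨χ, hχ, hTχ, RadonWigner.radon_eq_norm_sq hbar_pos hφ hφ1 hφ2 hF1 h
      hT.mem_covariantGraph hχ hTχ⟩
  · have hA := RadonWigner.ae_radonFourier_eq_ambiguity hbar_pos hφ hφ1 hφ2 hF1
    have hA2 := RadonWigner.memLp_ambiguity_plane hbar_pos hφ hφ2
    have hG := (memLp_congr_ae hA).2 hA2
    refine ⟨hG, ?_⟩
    rw [MemLp.toLp_congr hG hA2 hA]
    filter_upwards [RadonWigner.planeFourierL2_ambiguity hbar_pos hφ hφ1 hφ2 hF1] with z hz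
    rw [hz, inv_mul_cancel_left₀ hπ]
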